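/- All algebras are over $\mathbb C$, $\mathrm{Der}(A)$ denotes the Lie algebra of $\mathbb C$-linear derivations of a commutative algebra $A$, and $\mathbb N=\{1,2,\dots\}$. Let $R=\mathbb C[t,t^{-1},u]/(u^2-t^2-4t)$ and $S=\mathbb C[s,s^{-1},(s-1)^{-1}]$, let $\partial=d/ds$ on $S$, and let $D=(t+2)\frac{\partial}{\partial u}+u\frac{\partial}{\partial t}$, that is, the derivation of $R$ with $D(t)=u$, $D(u)=t+2$. For $k\in\mathbb Z$ put $e_k=t^kD$ and $d_k=t^kuD$ in $\mathrm{Der}(R)$ (the $3$-point Witt algebra). Let $f:R\to S$ be the algebra isomorphism with $f(t)=s^{-1}(s-1)^2$, $f(u)=s-s^{-1}$, so that $f^{-1}(s)=\frac{t+2+u}{2}$, and let $\Phi_f:\mathrm{Der}(R)\to\mathrm{Der}(S)$, $\Phi_f(x)=f\circ x\circ f^{-1}$. The elements $s^m\partial$ ($m\in\mathbb Z$) and $(s-1)^{-n}\partial$ ($n\in\mathbb N$) form a basis of $\mathrm{Der}(S)$. Let $\phi_1,\phi_2$ be the skew-symmetric bilinear forms on $\mathrm{Der}(S)$ that have the following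 values on pairs of basis elements, and vanish on all other pairs, except those obtained from the listed ones by skew symmetry: $$\phi_1(s^{k+1}\partial,s^{-l+1}\partial)=\delta_{k,l}(l^3-l)\quad(k,l\in\mathbb Z),$$ $$\phi_1(s^{-k}\partial,(s-1)^{-l}\partial)=\frac{(-1)^{l+1}(k+l+1)!}{(k-1)!\,(l-1)!}\quad(k,l\in\mathbb N),$$ $$\phi_2(s^{m}\partial,(s-1)^{-l+1}\partial)=\binom{m}{l+1}(l^3-l)\quad(m\ge 0,\ l\ge 2),$$ $$\phi_2((s-1)^{-k}\partial,s^{-l}\partial)=\frac{(-1)^{k+1}(k+l+1)!}{(k-1)!\,(l-1)!}\quad(k,l\in\mathbb N).$$ Put $\bar\phi_i(x,y)=\phi_i(\Phi_f(x),\Phi_f(y))$ for $x,y\in\mathrm{Der}(R)$, $i=1,2$. A $2$-cocycle on a Lie algebra $\mathfrak l$ is a bilinear form $\varphi:\mathfrak l\times\mathfrak l\to\mathbb C$ with $\varphi(x,y)=-\varphi(y,x)$ and $\varphi([x,y],z)+\varphi([y,z],x)+\varphi([z,x],y)=0$ for all $x,y,z$; it is a coboundary if $\varphi(x,y)=g([x,y])$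 for some linear functional $g:\mathfrak l\to\mathbb C$. **Theorem.** The elements $e_k,d_k$ ($k\in\mathbb Z$) form a basis of $\mathrm{Der}(R)$. The forms $\bar\phi_1$ and $\bar\phi_2$ are $2$-cocycles on $\mathrm{Der}(R)$ that are not coboundaries. For all $k,l\in\mathbb Z$, $$\bar\phi_1(e_k,e_l)=2(l^2-l)(2l-1)\delta_{k+l,1}+(l^3-l)\delta_{k+l,0},$$ $$\bar\phi_1(e_k,d_l)=-\bar\phi_1(d_l,e_k)=6(-1)^{k+l}2^{k+l}(k-1)kl\,\frac{(2k+2l-3)!!}{(k+l+1)!},$$ $$\bar\phi_1(d_k,d_l)=l(l+1)(l+2)\delta_{k+l,-2}+4l(2l+1)(l+1)\delta_{k+l,-1}+4l(2l-1)(2l+1)\delta_{k+l,0},$$ $$\bar\phi_2(e_k,e_l)=-2(l^3-l)\delta_{k+l,0}-4l(l-1)(2l-1)\delta_{k+l,1},$$ $$\bar\phi_2(e_k,d_l)=-\bar\phi_2(d_l,e_k)=0,$$ $$\bar\phi_2(d_k,d_l)=-2l(l+1)(l+2)\delta_{k+l,-2}-8l(l+1)(2l+1)\delta_{k+l,-1}-8l(2l-1)(2l+1)\delta_{k+l,0},$$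 and in particular $\bar\phi_2(d_k,d_l)=-2\bar\phi_1(d_k,d_l)$ and $\bar\phi_2(e_k,e_l)=-2\bar\phi_1(e_k,e_l)$. Here $(2n-1)!!=1\cdot3\cdots(2n-1)$ for $n\ge0$ (so $(-1)!!=1$), continued to negative odd integers by $(2n+1)!!=(2n+1)\,(2n-1)!!$ (so $(-3)!!=-1$, $(-5)!!=\frac13$), and $\frac1{n!}=0$ for integers $n<0$. -/

import Mathlib

noncomputable section

namespace ThreePoint

open Polynomial LaurentPolynomial

/-! ### Two-cocycles and two-coboundaries of a complex Lie algebra -/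

/-- A `2`-cocycle on a complex Lie algebra, with values in the trivial module `ℂ`. -/
structure IsTwoCocycle {L : Type*} [LieRing L] [LieAlgebra ℂ L] (φ : L →ₗ[ℂ] L →ₗ[ℂ] ℂ) :
    Prop where
  skew : ∀ x y : L, φ x y = -φ y x
  jacobi : ∀ x y z : L, φ ⁅x, y⁆ z + φ ⁅y, z⁆ x + φ ⁅z, x⁆ y = 0

/-- A `2`-coboundary: a bilinear form `(x, y) ↦ g ⁅x, y⁆` with `g` a linear functional. -/
def IsTwoCoboundary {L : Type*} [LieRing L] [LieAlgebra ℂ L] (φ : L →ₗ[ℂ] L →ₗ[ℂ] ℂ) : Prop :=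
  ∃ g : L →ₗ[ℂ] ℂ, ∀ x y : L, φ x y = g ⁅x, y⁆

/-! ### Derivations out of dual numbers, and conjugation of derivations -/

/-- An algebra section `a ↦ a + ε d(a)` of `A[ε] → A` gives the derivation `d`. -/
def derivationOfDual {A : Type*} [CommRing A] [Algebra ℂ A] (F : A →ₐ[ℂ] DualNumber A)
    (hF : ∀ a, (F a).fst = a) : Derivation ℂ A A :=
  Derivation.mk'
    { toFun := fun a => (F a).snd
      map_add' := fun a b => by simp
      map_smul' := fun c a => by simp }
    (fun a b => by simp [hF, mul_comm])

@[simp]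
theorem derivationOfDual_apply {A : Type*} [CommRing A] [Algebra ℂ A]
    (F : A →ₐ[ℂ] DualNumber A) (hF : ∀ a, (F a).fst = a) (a : A) :
    derivationOfDual F hF a = (F a).snd := rfl

/-- For an algebra isomorphism `f : A ≃ B`, the map `x ↦ f ∘ x ∘ f⁻¹` from `Der(A)` to
`Der(B)`. -/
def conjDer {A B : Type*} [CommRing A] [Algebra ℂ A] [CommRing B] [Algebra ℂ B]
    (f : A ≃ₐ[ℂ] B) : Derivation ℂ A A →ₗ[ℂ] Derivation ℂ B B where
  toFun x := Derivation.mk' (f.toLinearMap ∘ₗ x.toLinearMap ∘ₗ f.symm.toLinearMap)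
    (fun a b => by simp)
  map_add' x y := by ext; simp; rfl
  map_smul' c x := by ext; simp; rfl

@[simp]
theorem conjDer_apply {A B : Type*} [CommRing A] [Algebra ℂ A] [CommRing B] [Algebra ℂ B]
    (f : A ≃ₐ[ℂ] B) (x : Derivation ℂ A A) (b : B) : conjDer f x b = f (x (f.symm b)) := rfl

/-! ### The ring `S = ℂ[s, s⁻¹, (s - 1)⁻¹]` -/

/-- `S = ℂ[s, s⁻¹, (s - 1)⁻¹]`, the localization of `ℂ[s]` at `s (s - 1)`. -/
abbrev S : Type := Localization.Away (X * (X - 1) : ℂ[X])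

theorem isUnit_algebraMap_mul : IsUnit (algebraMap ℂ[X] S X * algebraMap ℂ[X] S (X - 1)) := by
  rw [← map_mul]
  exact IsLocalization.Away.algebraMap_isUnit _

/-- The coordinate `s`, as a unit of `S`. -/
def s : Sˣ := (isUnit_of_mul_isUnit_left isUnit_algebraMap_mul).unit

/-- The element `s - 1`, as a unit of `S`. -/
def s1 : Sˣ := (isUnit_of_mul_isUnit_right isUnit_algebraMap_mul).unit

theorem coe_s : (s : S) = algebraMap ℂ[X] S X := rfl

theorem coe_s1 : (s1 : S) = s - 1 := by
  change algebraMap ℂ[X] S (X - 1) = algebraMap ℂ[X] S X - 1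
  simp

/-- The universal property of `S`: `s` may be sent to any unit `a` with `a - 1` a unit. -/
def liftS {A : Type*} [CommRing A] [Algebra ℂ A] (a b : Aˣ) (h : (b : A) = a - 1) : S →ₐ[ℂ] A :=
  IsLocalization.Away.liftAlgHom (S := S) (X * (X - 1) : ℂ[X]) (f := aeval (a : A))
    (by simpa [h] using (a * b).isUnit)

@[simp]
theorem liftS_s {A : Type*} [CommRing A] [Algebra ℂ A] (a b : Aˣ) (h : (b : A) = a - 1) :
    liftS a b h s = a := by
  rw [liftS, coe_s, IsLocalization.Away.liftAlgHom_apply, IsLocalization.Away.lift_eq]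
  simp

theorem S_hom_ext {A : Type*} [CommRing A] [Algebra ℂ A] {F G : S →ₐ[ℂ] A}
    (h : F s = G s) : F = G := by
  apply AlgHom.coe_ringHom_injective
  apply IsLocalization.ringHom_ext (Submonoid.powers (X * (X - 1) : ℂ[X]))
  have : (F.comp (Algebra.algHom ℂ ℂ[X] S)) = (G.comp (Algebra.algHom ℂ ℂ[X] S)) :=
    Polynomial.algHom_ext h
  ext x
  · exact DFunLike.congr_fun this _
  · simpa [coe_s] using h

/-- Every element of `S` has the form `p(s) s⁻ⁿ (s - 1)⁻ⁿ`. -/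
theorem S_form (x : S) : ∃ (p : ℂ[X]) (n : ℕ), x = aeval (s : S) p * ((s⁻¹ * s1⁻¹ : Sˣ) : S) ^ n := by
  obtain ⟨n, p, h⟩ := IsLocalization.Away.surj (X * (X - 1) : ℂ[X]) x
  refine ⟨p, n, ?_⟩
  have h1 : aeval (s : S) p = algebraMap ℂ[X] S p := by
    rw [coe_s, aeval_algebraMap_apply]; simp
  have h2 : algebraMap ℂ[X] S (X * (X - 1)) = ((s * s1 : Sˣ) : S) := by
    rw [map_mul]; rfl
  rw [h1, ← h, h2, mul_assoc, ← mul_pow, ← Units.val_mul, ← mul_inv, mul_inv_cancel]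
  simp

theorem S_derivation_ext {d d' : Derivation ℂ S S} (h : d s = d' s) : d = d' := by
  have key : ∀ p : ℂ[X], d (aeval (s : S) p) = d' (aeval (s : S) p) := fun p => by
    rw [Derivation.map_aeval, Derivation.map_aeval, h]
  ext x
  obtain ⟨p, n, rfl⟩ := S_form x
  have hx : (aeval (s : S) ((X * (X - 1)) ^ n : ℂ[X])) * ((s⁻¹ * s1⁻¹ : Sˣ) : S) ^ n = 1 := by
    have : aeval (s : S) ((X * (X - 1)) : ℂ[X]) = ((s * s1 : Sˣ) : S) := by
      simp [coe_s1]
    rw [map_pow, this, ← mul_pow, ← Units.val_mul, ← mul_inv, mul_inv_cancel]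
    simp
  have h3 : d (((s⁻¹ * s1⁻¹ : Sˣ) : S) ^ n) = d' (((s⁻¹ * s1⁻¹ : Sˣ) : S) ^ n) := by
    rw [mul_comm] at hx
    rw [Derivation.leibniz_of_mul_eq_one d hx, Derivation.leibniz_of_mul_eq_one d' hx, key]
  rw [Derivation.leibniz, Derivation.leibniz, key, h3]

/-- The section `s ↦ s + ε` of `S[ε] → S`. -/
def dualS : S →ₐ[ℂ] DualNumber S :=
  liftS
    ((TrivSqZeroExt.isUnit_iff_isUnit_fst (R := S) (M := S)
      (x := TrivSqZeroExt.inl (s : S) + TrivSqZeroExt.inr 1)).2 (by simp)).unit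
    ((TrivSqZeroExt.isUnit_iff_isUnit_fst (R := S) (M := S)
      (x := TrivSqZeroExt.inl (s1 : S) + TrivSqZeroExt.inr 1)).2 (by simp)).unit
    (by simp [coe_s1, sub_add_eq_add_sub])

theorem dualS_fst (a : S) : (dualS a).fst = a := by
  have : (TrivSqZeroExt.fstHom ℂ S S).comp dualS = AlgHom.id ℂ S := S_hom_ext (by simp [dualS])
  exact DFunLike.congr_fun this a

/-- The derivation `∂ = d/ds` of `S`. -/
def partialS : Derivation ℂ S S := derivationOfDual dualS dualS_fst

@[simp]
theorem partialS_s : partialS s = 1 := by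
  simp [partialS, dualS]

/-- `Der(S) = S ∂`: the linear isomorphism `a ↦ a ∂`. -/
def derSEquiv : S ≃ₗ[ℂ] Derivation ℂ S S where
  toFun a := a • partialS
  map_add' a b := add_smul a b _
  map_smul' c a := smul_assoc c a _
  invFun d := d s
  left_inv a := by simp
  right_inv d := S_derivation_ext (by simp)

/-- The family `s ^ k` (`k ∈ ℤ`), `(s - 1) ^ (-l)` (`l ≥ 1`) of elements of `S`. -/
def familyS : ℤ ⊕ ℕ+ → S
  | .inl k => ((s ^ k : Sˣ) : S)
  | .inr l => ((s1 ^ (-(l : ℤ)) : Sˣ) : S)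

theorem mul_s_mem {x : S} (hx : x ∈ Submodule.span ℂ (Set.range familyS)) :
    x * s ∈ Submodule.span ℂ (Set.range familyS) := by
  induction hx using Submodule.span_induction with
  | zero => simp
  | add x y _ _ hx hy => rw [add_mul]; exact add_mem hx hy
  | smul c x _ hx => rw [smul_mul_assoc]; exact Submodule.smul_mem _ c hx
  | mem x hx =>
    obtain ⟨i, rfl⟩ := hx
    rcases i with k | l
    · have : familyS (.inl k) * s = familyS (.inl (k + 1)) := by
        simp [familyS, zpow_add_one]
      rw [this]
      exact Submodule.subset_span ⟨_, rfl⟩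
    · have h : familyS (.inr l) * s = ((s1 ^ (-(l : ℤ) + 1) : Sˣ) : S) + familyS (.inr l) := by
        simp only [familyS, zpow_add_one, Units.val_mul, coe_s1]
        ring
      rw [h]
      refine add_mem ?_ (Submodule.subset_span ⟨_, rfl⟩)
      by_cases hl : l = 1
      · subst hl
        exact Submodule.subset_span ⟨.inl 0, by simp [familyS]⟩
      · obtain ⟨m, rfl⟩ := PNat.exists_eq_succ_of_ne_one hl
        exact Submodule.subset_span ⟨.inr m, by simp [familyS]⟩

theorem mul_s1_inv_mem {x : S} (hx : x ∈ Submodule.span ℂ (Set.range familyS)) :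
    x * ((s1⁻¹ : Sˣ) : S) ∈ Submodule.span ℂ (Set.range familyS) := by
  have h1 : ((s1⁻¹ : Sˣ) : S) ∈ Submodule.span ℂ (Set.range familyS) :=
    Submodule.subset_span ⟨.inr 1, by simp [familyS]⟩
  have e : ((s1⁻¹ : Sˣ) : S) * ((s : S) - 1) = 1 := by rw [← coe_s1]; simp
  induction hx using Submodule.span_induction with
  | zero => simp
  | add x y _ _ hx hy => rw [add_mul]; exact add_mem hx hy
  | smul c x _ hx => rw [smul_mul_assoc]; exact Submodule.smul_mem _ c hx
  | mem x hx =>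
    obtain ⟨i, rfl⟩ := hx
    rcases i with k | l
    · induction k using Int.induction_on with
      | zero => simpa [familyS] using h1
      | succ n ih =>
        have : familyS (.inl (n + 1)) * ((s1⁻¹ : Sˣ) : S) =
            familyS (.inl n) + familyS (.inl n) * ((s1⁻¹ : Sˣ) : S) := by
          simp only [familyS, zpow_add_one, Units.val_mul]
          linear_combination ((s ^ (n : ℤ) : Sˣ) : S) * e
        rw [this]
        exact add_mem (Submodule.subset_span ⟨_, rfl⟩) ih
      | pred n ih =>
        have : familyS (.inl (-n - 1)) * ((s1⁻¹ : Sˣ) : S) =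
            familyS (.inl (-n)) * ((s1⁻¹ : Sˣ) : S) - familyS (.inl (-n - 1)) := by
          have e2 : ((s ^ (-(n : ℤ)) : Sˣ) : S) = ((s ^ (-(n : ℤ) - 1) : Sˣ) : S) * s := by
            rw [← Units.val_mul, ← zpow_add_one]; simp
          simp only [familyS, e2]
          linear_combination -((s ^ (-(n : ℤ) - 1) : Sˣ) : S) * e
        rw [this]
        exact sub_mem ih (Submodule.subset_span ⟨_, rfl⟩)
    · exact Submodule.subset_span ⟨.inr (l + 1), by
        rw [familyS, familyS, ← Units.val_mul, ← zpow_sub_one]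
        congr 2
        push_cast
        ring⟩

theorem mul_s_inv_mem {x : S} (hx : x ∈ Submodule.span ℂ (Set.range familyS)) :
    x * ((s⁻¹ : Sˣ) : S) ∈ Submodule.span ℂ (Set.range familyS) := by
  have h1 : ((s⁻¹ : Sˣ) : S) ∈ Submodule.span ℂ (Set.range familyS) :=
    Submodule.subset_span ⟨.inl (-1), by simp [familyS]⟩
  induction hx using Submodule.span_induction with
  | zero => simp
  | add x y _ _ hx hy => rw [add_mul]; exact add_mem hx hy
  | smul c x _ hx => rw [smul_mul_assoc]; exact Submodule.smul_mem _ c hx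
  | mem x hx =>
    obtain ⟨i, rfl⟩ := hx
    rcases i with k | l
    · exact Submodule.subset_span ⟨.inl (k - 1), by
        rw [familyS, familyS, ← Units.val_mul, ← zpow_sub_one]⟩
    · have e : ((s1⁻¹ : Sˣ) : S) * ((s : S) - 1) = 1 := by rw [← coe_s1]; simp
      have e' : (s : S) * ((s⁻¹ : Sˣ) : S) = 1 := by simp
      induction l using PNat.recOn with
      | one =>
        have : familyS (.inr 1) * ((s⁻¹ : Sˣ) : S) =
            familyS (.inr 1) - ((s⁻¹ : Sˣ) : S) := by
          simp only [familyS, PNat.val_ofNat, Nat.cast_one, zpow_neg_one]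
          linear_combination (-((s⁻¹ : Sˣ) : S)) * e + ((s1⁻¹ : Sˣ) : S) * e'
        rw [this]
        exact sub_mem (Submodule.subset_span ⟨_, rfl⟩) h1
      | succ l ih =>
        have e2 : ((s1 ^ (-((l + 1 : ℕ+) : ℤ)) : Sˣ) : S) =
            ((s1 ^ (-(l : ℤ)) : Sˣ) : S) * ((s1⁻¹ : Sˣ) : S) := by
          rw [← Units.val_mul, ← zpow_sub_one]
          congr 2
          push_cast
          ring
        have : familyS (.inr (l + 1)) * ((s⁻¹ : Sˣ) : S) =
            familyS (.inr (l + 1)) - familyS (.inr l) * ((s⁻¹ : Sˣ) : S) := by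
          simp only [familyS, e2]
          linear_combination ((s1 ^ (-(l : ℤ)) : Sˣ) : S) *
            ((-((s⁻¹ : Sˣ) : S)) * e + ((s1⁻¹ : Sˣ) : S) * e')
        rw [this]
        exact sub_mem (Submodule.subset_span ⟨_, rfl⟩) ih

theorem span_familyS : ⊤ ≤ Submodule.span ℂ (Set.range familyS) := by
  intro x _
  have h1 : (1 : S) ∈ Submodule.span ℂ (Set.range familyS) :=
    Submodule.subset_span ⟨.inl 0, by simp [familyS]⟩
  obtain ⟨p, n, rfl⟩ := S_form x
  induction n with
  | zero =>
    simp only [pow_zero, mul_one]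
    induction p using Polynomial.induction_on' with
    | add p q hp hq => rw [map_add]; exact add_mem (hp trivial) (hq trivial)
    | monomial n a =>
      rw [aeval_monomial, ← Algebra.smul_def]
      refine Submodule.smul_mem _ a ?_
      exact Submodule.subset_span ⟨.inl n, by simp [familyS]⟩
  | succ n ih =>
    rw [pow_succ, ← mul_assoc, Units.val_mul, ← mul_assoc]
    exact mul_s1_inv_mem (mul_s_inv_mem (ih trivial))

/-- The uniformizer, as a unit of the field of Laurent series. -/
def unif : (LaurentSeries ℂ)ˣ := Units.mk0 (HahnSeries.single 1 1) (by simp)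

theorem unif_zpow (k : ℤ) : ((unif ^ k : (LaurentSeries ℂ)ˣ) : LaurentSeries ℂ) =
    HahnSeries.single k (1 : ℂ) := by
  rw [RatFunc.single_zpow, Units.val_zpow_eq_zpow_val]
  rfl

/-- The Laurent series `x - 1`, as a unit. -/
def unifSubOne : (LaurentSeries ℂ)ˣ :=
  Units.mk0 (HahnSeries.single 1 1 - 1) (by
    intro h
    have := congrArg (fun x : LaurentSeries ℂ => x.coeff 0) h
    simp at this)

/-- The power series `1 + x`, as a unit. -/
def onePlus : (PowerSeries ℂ)ˣ :=
  ((PowerSeries.isUnit_iff_constantCoeff (φ := (1 + PowerSeries.X : PowerSeries ℂ))).2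
    (by simp)).unit

/-- The Laurent series `1 + x`, as a unit. -/
def unifAddOne : (LaurentSeries ℂ)ˣ :=
  Units.map (HahnSeries.ofPowerSeries ℤ ℂ).toMonoidHom onePlus

theorem coe_unifAddOne : (unifAddOne : LaurentSeries ℂ) = 1 + unif := by
  change HahnSeries.ofPowerSeries ℤ ℂ (1 + PowerSeries.X) = 1 + HahnSeries.single 1 1
  simp

/-- Expansion at `s = 0`. -/
def expandZero : S →ₐ[ℂ] LaurentSeries ℂ := liftS unif unifSubOne rfl

/-- Expansion at `s = 1`, in powers of `s - 1`. -/
def expandOne : S →ₐ[ℂ] LaurentSeries ℂ :=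
  liftS unifAddOne unif (by rw [coe_unifAddOne, add_sub_cancel_left])

theorem map_coe_zpow {A B : Type*} [CommRing A] [Algebra ℂ A] [CommRing B] [Algebra ℂ B]
    (F : A →ₐ[ℂ] B) (a : Aˣ) (b : Bˣ) (h : F a = b) (k : ℤ) :
    F ((a ^ k : Aˣ) : A) = ((b ^ k : Bˣ) : B) := by
  have : Units.map (F : A →* B) a = b := Units.ext h
  rw [← this, ← map_zpow]
  rfl

theorem expandZero_zpow (k : ℤ) :
    expandZero ((s ^ k : Sˣ) : S) = HahnSeries.single k (1 : ℂ) := by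
  rw [map_coe_zpow expandZero s unif (liftS_s _ _ _), unif_zpow]

theorem expandOne_s : expandOne (s : S) = unifAddOne := liftS_s _ _ _

theorem expandOne_zpow (k : ℤ) :
    expandOne ((s1 ^ k : Sˣ) : S) = HahnSeries.single k (1 : ℂ) := by
  rw [map_coe_zpow expandOne s1 unif, unif_zpow]
  rw [coe_s1, map_sub, map_one, expandOne_s, coe_unifAddOne, add_sub_cancel_left]

theorem expandOne_s_zpow (k : ℤ) : ∃ f : PowerSeries ℂ,
    expandOne ((s ^ k : Sˣ) : S) = HahnSeries.ofPowerSeries ℤ ℂ f := by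
  refine ⟨((onePlus ^ k : (PowerSeries ℂ)ˣ) : PowerSeries ℂ), ?_⟩
  rw [map_coe_zpow expandOne s unifAddOne expandOne_s, unifAddOne, ← map_zpow]
  rfl

/-- The `n`-th coefficient of an expansion, as a linear functional. -/
def coeffOf (F : S →ₐ[ℂ] LaurentSeries ℂ) (n : ℤ) : S →ₗ[ℂ] ℂ where
  toFun x := (F x).coeff n
  map_add' x y := by simp
  map_smul' c x := by
    rw [Algebra.smul_def, map_mul, AlgHom.commutes, HahnSeries.algebraMap_apply',
      PowerSeries.algebraMap_apply, Algebra.algebraMap_self_apply, HahnSeries.ofPowerSeries_C,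
      HahnSeries.C_apply, HahnSeries.coeff_single_zero_mul]
    rfl

theorem coeffOf_expandOne_inl (k : ℤ) (l : ℕ+) :
    coeffOf expandOne (-(l : ℤ)) (familyS (.inl k)) = 0 := by
  obtain ⟨f, hf⟩ := expandOne_s_zpow k
  change (expandOne ((s ^ k : Sˣ) : S)).coeff (-(l : ℤ)) = 0
  rw [hf, PowerSeries.coeff_coe, if_pos (by simp)]

theorem coeffOf_expandOne_inr (m l : ℕ+) :
    coeffOf expandOne (-(l : ℤ)) (familyS (.inr m)) = if m = l then 1 else 0 := by
  change (expandOne ((s1 ^ (-(m : ℤ)) : Sˣ) : S)).coeff (-(l : ℤ)) = _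
  rw [expandOne_zpow, HahnSeries.coeff_single]
  congr 1
  simp [eq_comm]

theorem coeffOf_expandZero_inl (m k : ℤ) :
    coeffOf expandZero k (familyS (.inl m)) = if m = k then 1 else 0 := by
  change (expandZero ((s ^ m : Sˣ) : S)).coeff k = _
  rw [expandZero_zpow, HahnSeries.coeff_single]
  congr 1
  simp [eq_comm]

theorem linearIndependent_familyS : LinearIndependent ℂ familyS := by
  rw [linearIndependent_iff]
  intro g hg
  have hr : ∀ l, g (.inr l) = 0 := by
    intro l
    have h := congrArg (coeffOf expandOne (-(l : ℤ))) hg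
    rw [Finsupp.apply_linearCombination, Finsupp.linearCombination_apply, Finsupp.sum,
      map_zero, Finset.sum_eq_single (.inr l)] at h
    · rwa [Function.comp_apply, coeffOf_expandOne_inr, if_pos rfl, smul_eq_mul, mul_one] at h
    · rintro (k | m) _ hne
      · rw [Function.comp_apply, coeffOf_expandOne_inl, smul_zero]
      · rw [Function.comp_apply, coeffOf_expandOne_inr,
          if_neg (fun h => hne (congrArg Sum.inr h)), smul_zero]
    · intro h; rw [Finsupp.notMem_support_iff.1 h, zero_smul]
  ext (k | l)
  · have h := congrArg (coeffOf expandZero k) hg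
    rw [Finsupp.apply_linearCombination, Finsupp.linearCombination_apply, Finsupp.sum,
      map_zero, Finset.sum_eq_single (.inl k)] at h
    · rwa [Function.comp_apply, coeffOf_expandZero_inl, if_pos rfl, smul_eq_mul, mul_one] at h
    · rintro (m | m) _ hne
      · rw [Function.comp_apply, coeffOf_expandZero_inl,
          if_neg (fun h => hne (congrArg Sum.inl h)), smul_zero]
      · rw [hr, zero_smul]
    · intro h; rw [Finsupp.notMem_support_iff.1 h, zero_smul]
  · exact hr l

/-- The basis `s ^ k` (`k ∈ ℤ`), `(s - 1) ^ (-l)` (`l ≥ 1`) of `S`. -/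
def basisS : Module.Basis (ℤ ⊕ ℕ+) ℂ S :=
  Module.Basis.mk linearIndependent_familyS span_familyS

/-- The basis `s ^ k ∂` (`k ∈ ℤ`), `(s - 1) ^ (-l) ∂` (`l ≥ 1`) of `Der(S)`. -/
def basisDerS : Module.Basis (ℤ ⊕ ℕ+) ℂ (Derivation ℂ S S) := basisS.map derSEquiv

theorem basisDerS_inl (k : ℤ) : basisDerS (.inl k) = ((s ^ k : Sˣ) : S) • partialS := by
  simp [basisDerS, basisS, familyS, derSEquiv]

theorem basisDerS_inr (l : ℕ+) :
    basisDerS (.inr l) = ((s1 ^ (-(l : ℤ)) : Sˣ) : S) • partialS := by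
  simp [basisDerS, basisS, familyS, derSEquiv]

/-! ### The two cocycles on `Der(S)` -/

/-- The value
`(k + l + 1)! / ((k - 1)! (l - 1)! (b - a) ^ (k + 1) (a - b) ^ (l + 1))`
of the form attached to the point `a` on the pair `((s - a) ^ (-k) ∂, (s - b) ^ (-l) ∂)`,
for `k, l ≥ 1`. -/
def polePair (a b : ℂ) (k l : ℕ) : ℂ :=
  ((k + l + 1).factorial : ℂ) /
    (((k - 1).factorial : ℂ) * ((l - 1).factorial : ℂ) * (b - a) ^ (k + 1) * (a - b) ^ (l + 1))

/-- The values of `φ₁` (attached to `s = 0`) on pairs of basis elements: with `m = k + 1` and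
`n = -l + 1`, the value on `(s ^ m ∂, s ^ n ∂)` is `δ_{k,l} (l ^ 3 - l)`. -/
def table₁ : ℤ ⊕ ℕ+ → ℤ ⊕ ℕ+ → ℂ
  | .inl m, .inl n => if m - 1 = 1 - n then ((1 - n : ℤ) : ℂ) ^ 3 - ((1 - n : ℤ) : ℂ) else 0
  | .inl m, .inr l => if m < 0 then polePair 0 1 (-m).toNat l else 0
  | .inr l, .inl m => if m < 0 then -polePair 0 1 (-m).toNat l else 0
  | .inr _, .inr _ => 0

/-- The value `C(k + 1, l + 1) (l ^ 3 - l)` or `polePair` of `φ₂` (attached to `s = 1`) on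
`(s ^ m ∂, (s - 1) ^ (-n) ∂)`, where `m = k + 1` and `-n = -l + 1`: the first for `m ≥ 0`, and
for `m < 0` the negative of the value on `((s - 1) ^ (-n) ∂, s ^ m ∂)`. -/
def mixed₂ : ℤ → ℕ+ → ℂ
  | .ofNat m, n => (m.choose (n + 2) : ℂ) * (((n : ℂ) + 1) ^ 3 - ((n : ℂ) + 1))
  | .negSucc m, n => -polePair 1 0 n (m + 1)

/-- The values of `φ₂` (attached to `s = 1`) on pairs of basis elements. -/
def table₂ : ℤ ⊕ ℕ+ → ℤ ⊕ ℕ+ → ℂ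
  | .inl m, .inr n => mixed₂ m n
  | .inr n, .inl m => -mixed₂ m n
  | .inl _, .inl _ => 0
  | .inr _, .inr _ => 0

/-- The bilinear form on `Der(S)` with prescribed values on pairs of basis elements. -/
def formOfTable (c : ℤ ⊕ ℕ+ → ℤ ⊕ ℕ+ → ℂ) :
    Derivation ℂ S S →ₗ[ℂ] Derivation ℂ S S →ₗ[ℂ] ℂ :=
  basisDerS.constr ℂ fun i => basisDerS.constr ℂ fun j => c i j

theorem formOfTable_basis (c : ℤ ⊕ ℕ+ → ℤ ⊕ ℕ+ → ℂ) (i j : ℤ ⊕ ℕ+) :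
    formOfTable c (basisDerS i) (basisDerS j) = c i j := by
  simp [formOfTable]

/-- The Cox–Guo–Lu–Zhao form `φ₁` on `Der(S)`. -/
def phi₁ : Derivation ℂ S S →ₗ[ℂ] Derivation ℂ S S →ₗ[ℂ] ℂ := formOfTable table₁

/-- The Cox–Guo–Lu–Zhao form `φ₂` on `Der(S)`. -/
def phi₂ : Derivation ℂ S S →ₗ[ℂ] Derivation ℂ S S →ₗ[ℂ] ℂ := formOfTable table₂

/-! ### The ring `R = ℂ[t, t⁻¹, u | u² = t² + 4 t]` and its derivation `D` -/

/-- `R = ℂ[t, t⁻¹, u] / (u² - (t² + 4 t))`. -/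
abbrev R : Type := AdjoinRoot (X ^ 2 - Polynomial.C (T 2 + 4 * T 1) : (LaurentPolynomial ℂ)[X])

/-- The element `t ^ k` of `R`, for an integer `k`. -/
def tpow (k : ℤ) : R := AdjoinRoot.of _ (T k)

/-- The element `u` of `R`. -/
def u : R := AdjoinRoot.root _

theorem tpow_zero : tpow 0 = 1 := by simp [tpow]

theorem tpow_add (k l : ℤ) : tpow (k + l) = tpow k * tpow l := by
  rw [tpow, T_add, map_mul, tpow, tpow]

theorem u_sq : u ^ 2 = tpow 1 ^ 2 + 4 * tpow 1 := by
  have h := AdjoinRoot.eval₂_root (X ^ 2 - Polynomial.C (T 2 + 4 * T 1) : (LaurentPolynomial ℂ)[X])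
  rw [eval₂_sub, eval₂_pow, eval₂_X, Polynomial.eval₂_C, sub_eq_zero] at h
  rw [u, h, tpow, ← map_pow, T_pow, map_add, map_mul, map_ofNat]
  rfl

/-- The coordinate `t` of `R`, as a unit. -/
def t : Rˣ where
  val := tpow 1
  inv := tpow (-1)
  val_inv := by rw [← tpow_add]; exact tpow_zero
  inv_val := by rw [← tpow_add]; exact tpow_zero

/-- The algebra map `ℂ[t, t⁻¹] → A` with `t ↦ a`. -/
def evalLaurent {A : Type*} [CommRing A] [Algebra ℂ A] (a : Aˣ) : LaurentPolynomial ℂ →ₐ[ℂ] A where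
  __ := LaurentPolynomial.eval₂ (algebraMap ℂ A) a
  commutes' := fun r => by
    change LaurentPolynomial.eval₂ (algebraMap ℂ A) a (algebraMap ℂ ℂ[T;T⁻¹] r) = _
    rw [← LaurentPolynomial.C_eq_algebraMap, LaurentPolynomial.eval₂_C]

@[simp]
theorem evalLaurent_T {A : Type*} [CommRing A] [Algebra ℂ A] (a : Aˣ) (n : ℤ) :
    evalLaurent a (T n) = ((a ^ n : Aˣ) : A) :=
  LaurentPolynomial.eval₂_T _ _ _

/-- The universal property of `R`: a unit `a` and an element `b` with `b² = a² + 4 a` give the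
algebra map `R → A` with `t ↦ a`, `u ↦ b`. -/
def liftR {A : Type*} [CommRing A] [Algebra ℂ A] (a : Aˣ) (b : A)
    (h : b ^ 2 = (a : A) ^ 2 + 4 * a) : R →ₐ[ℂ] A :=
  AdjoinRoot.liftAlgHom _ (evalLaurent a) b (by
    rw [eval₂_sub, eval₂_pow, eval₂_X, Polynomial.eval₂_C, h]
    have h4 : evalLaurent a 4 = 4 := map_ofNat (evalLaurent a) 4
    simp [h4])

theorem liftR_tpow {A : Type*} [CommRing A] [Algebra ℂ A] (a : Aˣ) (b : A)
    (h : b ^ 2 = (a : A) ^ 2 + 4 * a) (k : ℤ) : liftR a b h (tpow k) = ((a ^ k : Aˣ) : A) := by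
  rw [liftR, tpow, AdjoinRoot.liftAlgHom_of, evalLaurent_T]

@[simp]
theorem liftR_t {A : Type*} [CommRing A] [Algebra ℂ A] (a : Aˣ) (b : A)
    (h : b ^ 2 = (a : A) ^ 2 + 4 * a) : liftR a b h t = a := by
  change liftR a b h (tpow 1) = a
  rw [liftR_tpow, zpow_one]

@[simp]
theorem liftR_u {A : Type*} [CommRing A] [Algebra ℂ A] (a : Aˣ) (b : A)
    (h : b ^ 2 = (a : A) ^ 2 + 4 * a) : liftR a b h u = b := by
  rw [liftR, u, AdjoinRoot.liftAlgHom_root]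

theorem R_hom_ext {A : Type*} [CommRing A] [Algebra ℂ A] {F G : R →ₐ[ℂ] A}
    (ht : F t = G t) (hu : F u = G u) : F = G := by
  have h1 : (F : R →+* A).comp (AdjoinRoot.of _) = (G : R →+* A).comp (AdjoinRoot.of _) := by
    apply IsLocalization.ringHom_ext (Submonoid.powers (X : ℂ[X]))
    ext x
    · have e : algebraMap ℂ[X] ℂ[T;T⁻¹] (Polynomial.C x) = algebraMap ℂ _ x := by
        rw [LaurentPolynomial.algebraMap_eq_toLaurent, Polynomial.toLaurent_C,
          LaurentPolynomial.C_eq_algebraMap]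
      have e' : AdjoinRoot.of (X ^ 2 - Polynomial.C (T 2 + 4 * T 1) : (LaurentPolynomial ℂ)[X])
          (algebraMap ℂ _ x) = algebraMap ℂ R x := rfl
      simp only [RingHom.comp_apply, e, e']
      exact (F.commutes x).trans (G.commutes x).symm
    · simp only [RingHom.comp_apply, LaurentPolynomial.algebraMap_eq_toLaurent,
        Polynomial.toLaurent_X]
      exact ht
  have h2 : (F : R →+* A).comp (AdjoinRoot.mk _) = (G : R →+* A).comp (AdjoinRoot.mk _) := by
    apply Polynomial.ringHom_ext'
    · exact h1
    · exact hu
  apply AlgHom.ext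
  intro x
  obtain ⟨p, rfl⟩ := AdjoinRoot.mk_surjective x
  exact DFunLike.congr_fun h2 p

/-- The section `t ↦ t + ε u`, `u ↦ u + ε (t + 2)` of `R[ε] → R`. -/
def dualR : R →ₐ[ℂ] DualNumber R :=
  liftR
    ((TrivSqZeroExt.isUnit_iff_isUnit_fst (R := R) (M := R)
      (x := TrivSqZeroExt.inl (t : R) + TrivSqZeroExt.inr u)).2 (by simp)).unit
    (TrivSqZeroExt.inl u + TrivSqZeroExt.inr ((t : R) + 2))
    (by
      have h : u ^ 2 = (t : R) ^ 2 + 4 * t := u_sq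
      rw [IsUnit.unit_spec]
      have h4 : (4 : DualNumber R) = TrivSqZeroExt.inl 4 :=
        (map_ofNat (TrivSqZeroExt.inlHom R R) 4).symm
      rw [h4]
      ext
      · simpa [TrivSqZeroExt.fst_pow] using h
      · simp [pow_two]
        ring)

theorem dualR_fst (a : R) : (dualR a).fst = a := by
  have : (TrivSqZeroExt.fstHom ℂ R R).comp dualR = AlgHom.id ℂ R :=
    R_hom_ext (by simp [dualR]) (by simp [dualR])
  exact DFunLike.congr_fun this a

/-- The derivation `D = (t + 2) ∂/∂u + u ∂/∂t` of `R`, that is, the derivation with `D t = u` and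
`D u = t + 2`. -/
def D : Derivation ℂ R R := derivationOfDual dualR dualR_fst

theorem D_t : D t = u := by simp [D, dualR]

theorem D_u : D u = (t : R) + 2 := by simp [D, dualR]

/-- `e k = t ^ k D`. -/
def e (k : ℤ) : Derivation ℂ R R := ((t ^ k : Rˣ) : R) • D

/-- `d k = t ^ k u D`. -/
def d (k : ℤ) : Derivation ℂ R R := (((t ^ k : Rˣ) : R) * u) • D

/-! ### The isomorphism `R ≃ S` and the forms on `Der(R)` -/

/-- The homomorphism `R → S` with `t ↦ s⁻¹ (s - 1) ^ 2` and `u ↦ s - s⁻¹`. -/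
def fHom : R →ₐ[ℂ] S :=
  liftR (s⁻¹ * s1 ^ 2) ((s : S) - ((s⁻¹ : Sˣ) : S)) (by
    have h : (s : S) * ((s⁻¹ : Sˣ) : S) = 1 := by simp
    rw [Units.val_mul, Units.val_pow_eq_pow_val, coe_s1]
    generalize ((s⁻¹ : Sˣ) : S) = r at *
    generalize (s : S) = q at *
    linear_combination (4 * r * (q - 1) ^ 2 - q * (q - 2 * r + r * q ^ 2)) * h)

theorem t_mul_inv : (t : R) * ((t⁻¹ : Rˣ) : R) = 1 := by simp

theorem halves : (2⁻¹ : ℂ) • (2 : R) = 1 := by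
  rw [Algebra.smul_def, ← map_ofNat (algebraMap ℂ R) 2, ← map_mul]
  norm_num

theorem quarters : algebraMap ℂ R 2⁻¹ * algebraMap ℂ R 2⁻¹ * 4 = 1 := by
  rw [← map_ofNat (algebraMap ℂ R) 4, ← map_mul, ← map_mul]
  norm_num

/-- The image `(t + 2 + u) / 2` of `s`, with inverse `(t + 2 - u) / 2`. -/
def sImage : Rˣ where
  val := (2⁻¹ : ℂ) • ((t : R) + 2 + u)
  inv := (2⁻¹ : ℂ) • ((t : R) + 2 - u)
  val_inv := by
    have h : u ^ 2 = (t : R) ^ 2 + 4 * t := u_sq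
    rw [Algebra.smul_def, Algebra.smul_def]
    linear_combination quarters - (algebraMap ℂ R 2⁻¹) ^ 2 * h
  inv_val := by
    have h : u ^ 2 = (t : R) ^ 2 + 4 * t := u_sq
    rw [Algebra.smul_def, Algebra.smul_def]
    linear_combination quarters - (algebraMap ℂ R 2⁻¹) ^ 2 * h

/-- The image `(t + u) / 2` of `s - 1`, with inverse `(t⁻¹ u - 1) / 2`. -/
def s1Image : Rˣ where
  val := (2⁻¹ : ℂ) • ((t : R) + u)
  inv := (2⁻¹ : ℂ) • (((t⁻¹ : Rˣ) : R) * u - 1)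
  val_inv := by
    have h : u ^ 2 = (t : R) ^ 2 + 4 * t := u_sq
    rw [Algebra.smul_def, Algebra.smul_def]
    linear_combination quarters + (algebraMap ℂ R 2⁻¹) ^ 2 * (((t⁻¹ : Rˣ) : R) * h +
      (u + t + 4) * t_mul_inv)
  inv_val := by
    have h : u ^ 2 = (t : R) ^ 2 + 4 * t := u_sq
    rw [Algebra.smul_def, Algebra.smul_def]
    linear_combination quarters + (algebraMap ℂ R 2⁻¹) ^ 2 * (((t⁻¹ : Rˣ) : R) * h +
      (u + t + 4) * t_mul_inv)

/-- The homomorphism `S → R` with `s ↦ (t + 2 + u) / 2`. -/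
def gHom : S →ₐ[ℂ] R :=
  liftS sImage s1Image (by
    change (2⁻¹ : ℂ) • ((t : R) + u) = (2⁻¹ : ℂ) • ((t : R) + 2 + u) - 1
    rw [← halves, ← smul_sub]
    congr 1
    ring)

theorem gHom_s : gHom s = (2⁻¹ : ℂ) • ((t : R) + 2 + u) := liftS_s _ _ _

theorem gHom_s_inv : gHom ((s⁻¹ : Sˣ) : S) = (2⁻¹ : ℂ) • ((t : R) + 2 - u) := by
  have h := map_coe_zpow gHom s sImage gHom_s (-1)
  rwa [zpow_neg_one, zpow_neg_one] at h

theorem fHom_t : fHom t = ((s⁻¹ : Sˣ) : S) * ((s : S) - 1) ^ 2 := by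
  rw [← coe_s1]; exact liftR_t _ _ _

theorem fHom_u : fHom u = (s : S) - ((s⁻¹ : Sˣ) : S) := liftR_u _ _ _

/-- The isomorphism `f : R ≃ S` with `t ↦ s⁻¹ (s - 1) ^ 2` and `u ↦ s - s⁻¹`. -/
def f : R ≃ₐ[ℂ] S :=
  AlgEquiv.ofAlgHom fHom gHom
    (S_hom_ext (by
      have h : (s : S) * ((s⁻¹ : Sˣ) : S) = 1 := by simp
      have hw : algebraMap ℂ S 2⁻¹ * 2 = 1 := by
        rw [← map_ofNat (algebraMap ℂ S) 2, ← map_mul]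
        norm_num
      rw [AlgHom.comp_apply, gHom_s, map_smul, map_add, map_add, fHom_t, fHom_u, map_ofNat,
        AlgHom.id_apply, Algebra.smul_def]
      linear_combination algebraMap ℂ S 2⁻¹ * ((s : S) - 2) * h + (s : S) * hw))
    (R_hom_ext
      (by
        have h : u ^ 2 = (t : R) ^ 2 + 4 * t := u_sq
        have hw := halves
        rw [Algebra.smul_def] at hw
        rw [AlgHom.comp_apply, fHom_t, map_mul, map_pow, map_sub, map_one, gHom_s, gHom_s_inv,
          AlgHom.id_apply, Algebra.smul_def, Algebra.smul_def]
        generalize algebraMap ℂ R 2⁻¹ = w at *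
        have e1 : w * ((t : R) + 2 + u) - 1 = w * (t + u) := by linear_combination hw
        rw [e1]
        linear_combination w ^ 3 * (2 - t - u) * h + (t : R) * (4 * w ^ 2 + 2 * w + 1) * hw)
      (by
        have hw := halves
        rw [Algebra.smul_def] at hw
        rw [AlgHom.comp_apply, fHom_u, map_sub, gHom_s, gHom_s_inv, AlgHom.id_apply,
          Algebra.smul_def, Algebra.smul_def]
        linear_combination u * hw))

theorem f_t : f t = ((s⁻¹ : Sˣ) : S) * ((s : S) - 1) ^ 2 := fHom_t

theorem f_u : f u = (s : S) - ((s⁻¹ : Sˣ) : S) := fHom_u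

/-- The isomorphism `Φ_f : Der(R) → Der(S)`, `x ↦ f x f⁻¹`. -/
def Phi : Derivation ℂ R R →ₗ[ℂ] Derivation ℂ S S := conjDer f

/-- The pullback `φ̄₁(x, y) = φ₁(Φ_f x, Φ_f y)`. -/
def phiBar₁ : Derivation ℂ R R →ₗ[ℂ] Derivation ℂ R R →ₗ[ℂ] ℂ := phi₁.compl₁₂ Phi Phi

/-- The pullback `φ̄₂(x, y) = φ₂(Φ_f x, Φ_f y)`. -/
def phiBar₂ : Derivation ℂ R R →ₗ[ℂ] Derivation ℂ R R →ₗ[ℂ] ℂ := phi₂.compl₁₂ Phi Phi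

/-! ### Conventions for the double factorial and the reciprocal factorial -/

/-- `oddDoubleFactorial n = (2 n - 1)!!` for every integer `n`: the product `1 · 3 ⋯ (2 n - 1)`
for `n ≥ 0` (so `(-1)!! = 1`), continued to negative `n` by
`(2 n + 1)!! = (2 n + 1) (2 n - 1)!!`. -/
def oddDoubleFactorial : ℤ → ℂ
  | .ofNat n => ∏ i ∈ Finset.range n, (2 * (i : ℂ) + 1)
  | .negSucc n => ∏ i ∈ Finset.range (n + 1), (-(2 * (i : ℂ) + 1))⁻¹

theorem oddDoubleFactorial_succ (n : ℤ) :
    oddDoubleFactorial (n + 1) = (2 * n + 1) * oddDoubleFactorial n := by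
  rcases n with n | n
  · change oddDoubleFactorial (Int.ofNat (n + 1)) = _
    simp [oddDoubleFactorial, Finset.prod_range_succ, mul_comm]
  · rcases n with _ | n
    · simp [oddDoubleFactorial]; norm_num
    · have : Int.negSucc (n + 1) + 1 = Int.negSucc n := by omega
      rw [this]
      simp only [oddDoubleFactorial, Finset.prod_range_succ _ (n + 1)]
      have h : (2 * ((n + 1 : ℕ) : ℂ) + 1) ≠ 0 := by
        exact_mod_cast (by omega : 2 * (n + 1) + 1 ≠ 0)
      have h2 : (2 * ((Int.negSucc (n + 1) : ℤ) : ℂ) + 1) = -(2 * ((n + 1 : ℕ) : ℂ) + 1) := by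
        rw [Int.cast_negSucc]; push_cast; ring
      rw [h2, mul_comm, mul_assoc, inv_mul_cancel₀ (neg_ne_zero.2 h), mul_one]

/-- `1 / n!` for `n ≥ 0`, and `0` for `n < 0`. -/
def invFactorial : ℤ → ℂ
  | .ofNat n => ((n.factorial : ℂ))⁻¹
  | .negSucc _ => 0

end ThreePoint

end

noncomputable section

namespace ThreePoint

open Polynomial LaurentPolynomial

/-! ### The bilinear form of a derivation and an invariant functional -/

/-! Both forms are residue pairings: `phi₁ (a ∂) (b ∂)` is the residue at `s = 0`, and `phi₂ (a ∂)
(b ∂)` the residue at `s = 1`, of `a''' b ds`. This is checked on the basis, where the factorials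
and binomials of the tables turn out to be expansion coefficients of `s ^ m (s - 1) ^ n`
(`table₁_eq_resZero`, `table₂_eq_resOne`). A residue kills derivatives, and for any functional with
that property `(a, b) ↦ r (a''' b)` is a cocycle by integration by parts (`functional_third_skew`,
`functional_third_jacobi`).

On `R` the point is that `D` fixes `f⁻¹(s) = (t + 2 + u) / 2`, so `D` corresponds to `s ∂`. In this
logarithmic coordinate the pairing of `a D` and `b D` becomes `ρ ((D³ a - D a) b)`, where `ρ` is the
residue of `f(·) ds / s` (`form_smul_D`). Since `ρ` kills the image of `D`, the formulas for `D (t ^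
k)` and `D (t ^ k u)` determine it from the two numbers `ρ 1` and `ρ (t⁻¹ u)` (`functional_tp`,
`functional_tp_mul_u`). These numbers are `(1, -1)` at `s = 0` and `(0, 2)` at `s = 1`.

All values follow. The pairs `(e, e)` and `(d, d)` see only `ρ (t⁻¹ u)`, whence the ratio `-2`; the
pairs `(e, d)` see only `ρ 1`, whence the double factorials for the first form and zero for the
second. Moreover `(a, b) ↦ ρ (a b)` at `s = 1` pairs each `t ^ k` with `t ^ (-1 - k) u` alone, which
proves linear independence. A coboundary would have to be linear in `k` on `(e (-k), e k)`, but the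
values are proportional to `k³ - k`. -/

theorem functional_third_skew {A : Type*} [CommRing A] [Algebra ℂ A] (δ : Derivation ℂ A A)
    (r : A →ₗ[ℂ] ℂ) (hr : ∀ a, r (δ a) = 0) (a b : A) :
    r (δ (δ (δ a)) * b) = -r (δ (δ (δ b)) * a) := by
  -- Integration by parts three times: the derivative of this expression is `a''' b + a b'''`.
  have h := hr (δ (δ a) * b - δ a * δ b + a * δ (δ b))
  simp only [map_add, map_sub, Derivation.leibniz, smul_eq_mul] at h
  rw [← add_eq_zero_iff_eq_neg, ← h, ← map_add]
  simp only [← map_add, ← map_sub]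
  congr 1
  ring

theorem functional_third_jacobi {A : Type*} [CommRing A] [Algebra ℂ A] (δ : Derivation ℂ A A)
    (r : A →ₗ[ℂ] ℂ) (hr : ∀ a, r (δ a) = 0) (a b c : A) :
    r (δ (δ (δ (a * δ b - b * δ a))) * c) + r (δ (δ (δ (b * δ c - c * δ b))) * a) +
      r (δ (δ (δ (c * δ a - a * δ c))) * b) = 0 := by
  -- The argument is `-2` times the Wronskian determinant of `a, b, c`. In the cyclic sum the fourth
  -- derivatives cancel and `2 ∑ c (a' b'' - a'' b')'` remains; this is twice the derivative of the
  -- Wronskian, because `∑ c' (a' b'' - a'' b')` is a determinant with a repeated row.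
  have h := hr (2 * (a * (δ (δ b) * δ c - δ b * δ (δ c)) +
    b * (δ (δ c) * δ a - δ c * δ (δ a)) + c * (δ (δ a) * δ b - δ a * δ (δ b))))
  rw [← neg_eq_zero, ← map_neg] at h
  rw [← h, ← map_add, ← map_add]
  congr 1
  have h2 : δ 2 = 0 := by
    rw [← map_ofNat (algebraMap ℂ A) 2, Derivation.map_algebraMap]
  simp only [map_add, map_sub, Derivation.leibniz, smul_eq_mul, h2]
  ring

theorem derivation_units_zpow {A : Type*} [CommRing A] [Algebra ℂ A] (δ : Derivation ℂ A A)
    (a : Aˣ) (k : ℤ) :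
    δ ((a ^ k : Aˣ) : A) = (k : ℂ) • (((a ^ (k - 1) : Aˣ) : A) * δ a) := by
  have e (n : ℤ) : ((a ^ (n + 1) : Aˣ) : A) = ((a ^ n : Aˣ) : A) * a := by
    rw [zpow_add_one, Units.val_mul]
  induction k using Int.induction_on with
  | zero => simp
  | succ n ih =>
    have e1 := e (n - 1)
    rw [sub_add_cancel] at e1
    rw [e, Derivation.leibniz, ih, add_sub_cancel_right]
    simp only [smul_eq_mul]
    simp only [Algebra.smul_def, e1, Int.cast_add, Int.cast_one, map_add, map_one]
    ring
  | pred n ih =>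
    have e1 := e (-n - 1)
    have e2 := e (-n - 1 - 1)
    rw [sub_add_cancel] at e1 e2
    rw [e1, Derivation.leibniz, smul_eq_mul, smul_eq_mul] at ih
    have hu : (a : A) * ((a⁻¹ : Aˣ) : A) = 1 := by simp
    simp only [Algebra.smul_def, e2, Int.cast_sub, Int.cast_one, map_sub, map_one]
      at ih ⊢
    -- In the downward step `ih` is the Leibniz rule for `a ^ (-n - 1) * a`, which gives the wanted
    -- derivative only up to the factor `a`; `hu` cancels it.
    linear_combination ((a⁻¹ : Aˣ) : A) * ih - (δ (((a ^ (-(n : ℤ) - 1 - 1) : Aˣ) : A) * a) -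
      ((algebraMap ℂ A) ((-(n : ℤ) : ℤ) : ℂ) - 1) * ((a ^ (-(n : ℤ) - 1 - 1) : Aˣ) : A) * δ a) * hu

/-! ### Conjugation of derivations -/

theorem conjDer_lie {A B : Type*} [CommRing A] [Algebra ℂ A] [CommRing B] [Algebra ℂ B]
    (f : A ≃ₐ[ℂ] B) (x y : Derivation ℂ A A) :
    conjDer f ⁅x, y⁆ = ⁅conjDer f x, conjDer f y⁆ := by
  ext b
  simp [Derivation.commutator_apply]

theorem conjDer_injective {A B : Type*} [CommRing A] [Algebra ℂ A] [CommRing B] [Algebra ℂ B]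
    (f : A ≃ₐ[ℂ] B) : Function.Injective (conjDer f) := by
  intro x y h
  ext a
  have := DFunLike.congr_fun h (f a)
  simpa using this

theorem IsTwoCocycle.compl₁₂_conjDer {A B : Type*} [CommRing A] [Algebra ℂ A] [CommRing B]
    [Algebra ℂ B] {φ : Derivation ℂ B B →ₗ[ℂ] Derivation ℂ B B →ₗ[ℂ] ℂ} (hφ : IsTwoCocycle φ)
    (f : A ≃ₐ[ℂ] B) : IsTwoCocycle (φ.compl₁₂ (conjDer f) (conjDer f)) where
  skew x y := hφ.skew _ _
  jacobi x y z := by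
    simp only [LinearMap.compl₁₂_apply, conjDer_lie]
    exact hφ.jacobi _ _ _

/-! ### Residues on `S` -/

/-- The element `s ^ m (s - 1) ^ n` of `S`. -/
def monoS (m n : ℤ) : S := ((s ^ m * s1 ^ n : Sˣ) : S)

theorem monoS_mul (m n p q : ℤ) : monoS m n * monoS p q = monoS (m + p) (n + q) := by
  rw [monoS, monoS, monoS, ← Units.val_mul, zpow_add, zpow_add, mul_mul_mul_comm]

theorem coe_s_eq_monoS : (s : S) = monoS 1 0 := by simp [monoS]

theorem coe_s_inv_eq_monoS : ((s⁻¹ : Sˣ) : S) = monoS (-1) 0 := by simp [monoS]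

theorem familyS_inl (k : ℤ) : familyS (.inl k) = monoS k 0 := by simp [familyS, monoS]

theorem familyS_inr (l : ℕ+) : familyS (.inr l) = monoS 0 (-(l : ℤ)) := by simp [familyS, monoS]

/-- The relation `s = (s - 1) + 1`; it drives the Pascal recursions for the residues below. -/
theorem monoS_add_one_left (m n : ℤ) : monoS (m + 1) n = monoS m (n + 1) + monoS m n := by
  simp only [monoS, zpow_add_one, Units.val_mul, coe_s1]
  ring

theorem partialS_s1 : partialS (s1 : S) = 1 := by
  rw [coe_s1, map_sub, partialS_s, Derivation.map_one_eq_zero, sub_zero]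

theorem partialS_monoS (m n : ℤ) :
    partialS (monoS m n) = (m : ℂ) • monoS (m - 1) n + (n : ℂ) • monoS m (n - 1) := by
  simp only [monoS, Units.val_mul, Derivation.leibniz, derivation_units_zpow, partialS_s,
    partialS_s1, smul_eq_mul, mul_one]
  simp only [Algebra.smul_def]
  ring

/-- The residue of `a ds` at `s = 0`. -/
def resZero : S →ₗ[ℂ] ℂ := coeffOf expandZero (-1)

/-- The residue of `a ds` at `s = 1`. -/
def resOne : S →ₗ[ℂ] ℂ := coeffOf expandOne (-1)

theorem isUnit_X_sub_one : IsUnit (PowerSeries.X - 1 : PowerSeries ℂ) :=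
  PowerSeries.isUnit_iff_constantCoeff.2 (by simp)

theorem expandZero_s1 : expandZero (s1 : S) =
    (Units.map (HahnSeries.ofPowerSeries ℤ ℂ).toMonoidHom isUnit_X_sub_one.unit :
      (LaurentSeries ℂ)ˣ) := by
  have h : expandZero (s : S) = unif := liftS_s _ _ _
  rw [coe_s1, map_sub, map_one, h]
  change HahnSeries.single 1 1 - 1 = HahnSeries.ofPowerSeries ℤ ℂ (PowerSeries.X - 1)
  simp

/-- At `s = 0` the element `s - 1` expands to an invertible power series, so no power of it creates
a pole. -/
theorem resZero_monoS_of_nonneg {m : ℤ} (hm : 0 ≤ m) (n : ℤ) : resZero (monoS m n) = 0 := by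
  lift m to ℕ using hm
  change (expandZero (monoS m n)).coeff (-1) = 0
  rw [monoS, Units.val_mul, map_mul, map_coe_zpow _ _ _ expandZero_s1, expandZero_zpow,
    ← map_zpow, HahnSeries.coeff_single_mul, one_mul]
  change (HahnSeries.ofPowerSeries ℤ ℂ _).coeff _ = 0
  rw [PowerSeries.coeff_coe, if_pos (by omega)]

theorem resZero_monoS_zero_right (m : ℤ) : resZero (monoS m 0) = if m = -1 then 1 else 0 := by
  rw [← familyS_inl]
  exact coeffOf_expandZero_inl m (-1)

theorem resOne_monoS_of_nonneg (m : ℤ) {n : ℤ} (hn : 0 ≤ n) : resOne (monoS m n) = 0 := by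
  lift n to ℕ using hn
  change (expandOne (monoS m n)).coeff (-1) = 0
  rw [monoS, Units.val_mul, map_mul, expandOne_zpow, HahnSeries.coeff_mul_single]
  obtain ⟨f, hf⟩ := expandOne_s_zpow m
  rw [hf, PowerSeries.coeff_coe, if_pos (by omega), zero_mul]

theorem resOne_monoS_zero_left (n : ℤ) : resOne (monoS 0 n) = if n = -1 then 1 else 0 := by
  change (expandOne (monoS 0 n)).coeff (-1) = _
  rw [monoS, zpow_zero, one_mul, expandOne_zpow, HahnSeries.coeff_single]
  congr 1
  simp [eq_comm]

theorem resZero_partialS (a : S) : resZero (partialS a) = 0 := by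
  suffices resZero ∘ₗ partialS.toLinearMap = 0 from LinearMap.congr_fun this a
  refine basisS.ext fun i => ?_
  rcases i with k | l
  · simp [basisS, familyS_inl, partialS_monoS, resZero_monoS_zero_right, sub_eq_iff_eq_add]
  · simp [basisS, familyS_inr, partialS_monoS, resZero_monoS_of_nonneg]

theorem resOne_partialS (a : S) : resOne (partialS a) = 0 := by
  suffices resOne ∘ₗ partialS.toLinearMap = 0 from LinearMap.congr_fun this a
  refine basisS.ext fun i => ?_
  rcases i with k | l
  · simp [basisS, familyS_inl, partialS_monoS, resOne_monoS_of_nonneg]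
  · simp [basisS, familyS_inr, partialS_monoS, resOne_monoS_zero_left, sub_eq_iff_eq_add]

/-- The coefficient of `s ^ j` in `(s - 1) ^ (-l - 1) = (-1) ^ (l + 1) (1 - s) ^ (-l - 1)`, obtained
by a double induction through Pascal's rule. -/
theorem resZero_monoS_neg (l j : ℕ) :
    resZero (monoS (-(j : ℤ) - 1) (-(l : ℤ) - 1)) = (-1) ^ (l + 1) * ((l + j).choose l : ℂ) := by
  have key (m n : ℤ) : resZero (monoS m n) = resZero (monoS (m + 1) n) -
      resZero (monoS m (n + 1)) := by
    rw [monoS_add_one_left, map_add]; ring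
  induction l generalizing j with
  | zero =>
    induction j with
    | zero =>
      rw [key]
      simp [resZero_monoS_zero_right, resZero_monoS_of_nonneg]
    | succ j ih =>
      rw [key]
      push_cast at ih ⊢
      rw [show -((j : ℤ) + 1) - 1 + 1 = -j - 1 by ring, ih,
        resZero_monoS_zero_right, if_neg (by omega)]
      simp
  | succ l ihl =>
    induction j with
    | zero =>
      rw [key]
      have := ihl 0
      push_cast at this ⊢
      rw [show -((l : ℤ) + 1) - 1 + 1 = -l - 1 by ring, this,
        resZero_monoS_of_nonneg le_rfl]
      simp [pow_succ]
    | succ j ih =>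
      rw [key]
      have := ihl (j + 1)
      push_cast at ih this ⊢
      rw [show -((l : ℤ) + 1) - 1 + 1 = -l - 1 by ring, this,
        show -((j : ℤ) + 1) - 1 + 1 = -j - 1 by ring, ih,
        show l + 1 + (j + 1) = (l + 1 + j) + 1 by ring, Nat.choose_succ_succ,
        show l + (j + 1) = l + 1 + j by ring]
      push_cast
      ring

theorem resOne_monoS_natCast (m j : ℕ) : resOne (monoS m (-(j : ℤ) - 1)) = (m.choose j : ℂ) := by
  induction m generalizing j with
  | zero =>
    rw [Nat.cast_zero, resOne_monoS_zero_left]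
    rcases j with _ | j
    · simp
    · rw [if_neg (by omega)]; simp
  | succ m ih =>
    rw [Nat.cast_succ, monoS_add_one_left, map_add, ih]
    rcases j with _ | j
    · rw [resOne_monoS_of_nonneg _ (by simp)]
      simp
    · rw [show -((j + 1 : ℕ) : ℤ) - 1 + 1 = -j - 1 by push_cast; ring, ih, Nat.choose_succ_succ]
      push_cast
      ring

/-- The coefficient of `(s - 1) ^ j` in `(1 + (s - 1)) ^ (-l - 1)`, that is, a binomial coefficient
with negative upper index. -/
theorem resOne_monoS_neg (l j : ℕ) :
    resOne (monoS (-(l : ℤ) - 1) (-(j : ℤ) - 1)) = (-1) ^ j * ((l + j).choose l : ℂ) := by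
  have key (m n : ℤ) : resOne (monoS m n) = resOne (monoS (m + 1) n) -
      resOne (monoS m (n + 1)) := by
    rw [monoS_add_one_left, map_add]; ring
  induction l generalizing j with
  | zero =>
    induction j with
    | zero =>
      rw [key]
      simp [resOne_monoS_zero_left, resOne_monoS_of_nonneg]
    | succ j ih =>
      rw [key]
      push_cast at ih ⊢
      rw [show -((j : ℤ) + 1) - 1 + 1 = -j - 1 by ring, ih,
        resOne_monoS_zero_left, if_neg (by omega)]
      simp [pow_succ]
  | succ l ihl =>
    induction j with
    | zero =>
      rw [key]
      have := ihl 0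
      push_cast at this ⊢
      rw [show -((l : ℤ) + 1) - 1 + 1 = -l - 1 by ring, this,
        resOne_monoS_of_nonneg _ le_rfl]
      simp
    | succ j ih =>
      rw [key]
      have := ihl (j + 1)
      push_cast at ih this ⊢
      rw [show -((l : ℤ) + 1) - 1 + 1 = -l - 1 by ring, this,
        show -((j : ℤ) + 1) - 1 + 1 = -j - 1 by ring, ih,
        show l + 1 + (j + 1) = (l + 1 + j) + 1 by ring, Nat.choose_succ_succ,
        show l + (j + 1) = l + 1 + j by ring]
      push_cast
      ring

/-! ### The two forms on `Der(S)` as residues -/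

theorem partialS_third_inl (m : ℤ) : partialS (partialS (partialS (familyS (.inl m)))) =
    ((m : ℂ) * (m - 1) * (m - 2)) • monoS (m - 3) 0 := by
  simp only [familyS_inl, partialS_monoS, Int.cast_zero, zero_smul, add_zero, Derivation.map_smul,
    smul_smul, Int.cast_sub, Int.cast_one]
  congr 2 <;> ring

theorem partialS_third_inr (l : ℕ+) : partialS (partialS (partialS (familyS (.inr l)))) =
    (-((l : ℂ) * (l + 1) * (l + 2))) • monoS 0 (-(l : ℤ) - 3) := by
  simp only [familyS_inr, partialS_monoS, Int.cast_zero, zero_smul, zero_add, Derivation.map_smul,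
    smul_smul]
  congr 2
  · push_cast; ring
  · ring

theorem table₁_skew (i j : ℤ ⊕ ℕ+) : table₁ i j = -table₁ j i := by
  rcases i with m | l <;> rcases j with n | k
  · simp only [table₁]
    by_cases h : m - 1 = 1 - n
    · rw [if_pos h, if_pos (by omega), show (1 - m : ℤ) = -(1 - n) by omega]
      push_cast
      ring
    · rw [if_neg h, if_neg (by omega), neg_zero]
  · simp only [table₁]; split_ifs <;> simp
  · simp only [table₁]; split_ifs <;> simp
  · simp [table₁]

theorem table₂_skew (i j : ℤ ⊕ ℕ+) : table₂ i j = -table₂ j i := by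
  rcases i with m | l <;> rcases j with n | k <;> simp [table₂]

/-- The cubic factor comes from the third derivative and the binomial from the residue; together
they give the factorials of `polePair` at the indices `k + 1` and `l + 1`. -/
theorem third_factor_mul_choose (k l : ℕ) :
    ((k : ℂ) + 1) * (k + 2) * (k + 3) * ((l + (k + 3)).choose l : ℂ) =
      ((k + 1 + (l + 1) + 1).factorial : ℂ) / ((k.factorial : ℂ) * (l.factorial : ℂ)) := by
  have hk : (k.factorial : ℂ) ≠ 0 := by exact_mod_cast k.factorial_ne_zero
  have hl : (l.factorial : ℂ) ≠ 0 := by exact_mod_cast l.factorial_ne_zero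
  have hc := Nat.add_choose_mul_factorial_mul_factorial (k + 3) l
  rw [show k + 3 + l = k + 1 + (l + 1) + 1 by ring] at hc
  rw [show l + (k + 3) = k + 1 + (l + 1) + 1 by ring]
  rw [eq_div_iff (mul_ne_zero hk hl), ← hc]
  simp only [Nat.factorial_succ]
  push_cast
  ring

theorem resZero_third_inl_inr (m : ℤ) (l : ℕ+) :
    resZero (partialS (partialS (partialS (familyS (.inl m)))) * familyS (.inr l)) =
      table₁ (.inl m) (.inr l) := by
  rw [partialS_third_inl, familyS_inr, smul_mul_assoc, monoS_mul, map_smul, table₁, add_zero,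
    zero_add, smul_eq_mul]
  split_ifs with hm
  · obtain ⟨k, rfl⟩ : ∃ k : ℕ, m = -(k : ℤ) - 1 := ⟨(-m - 1).toNat, by omega⟩
    obtain ⟨l, rfl⟩ : ∃ l' : ℕ, l = l'.succPNat := ⟨l.natPred, by simp⟩
    have h := resZero_monoS_neg l (k + 3)
    have e1 : -(k : ℤ) - 1 - 3 = -((k + 3 : ℕ) : ℤ) - 1 := by push_cast; ring
    have e2 : -((l.succPNat : ℕ) : ℤ) = -(l : ℤ) - 1 := by simp; ring
    have e3 : (-(-(k : ℤ) - 1)).toNat = k + 1 := by omega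
    have hf := third_factor_mul_choose k l
    rw [e1, e2, e3, h, polePair, Nat.succPNat_coe, Nat.succ_eq_add_one, add_tsub_cancel_right,
      add_tsub_cancel_right, sub_zero, zero_sub, one_pow, mul_one, ← div_div, ← hf]
    -- `polePair` carries its sign in the denominator and the residue in the numerator; they agree
    -- because the square of the sign is `1`.
    have : ((-1 : ℂ) ^ (l + 1 + 1)) ≠ 0 := by simp
    rw [eq_div_iff this]
    have hs : ((-1 : ℂ) ^ l) ^ 2 = 1 := by rw [← pow_mul, mul_comm, pow_mul]; simp
    push_cast
    linear_combination ((k : ℂ) + 1) * (k + 2) * (k + 3) * ((l + (k + 3)).choose l : ℂ) * hs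
  · by_cases h3 : 3 ≤ m
    · rw [resZero_monoS_of_nonneg (by omega), mul_zero]
    -- Here `s ^ (m - 3)` does have a pole, but the factor `m (m - 1) (m - 2)` vanishes.
    · obtain rfl | rfl | rfl : m = 0 ∨ m = 1 ∨ m = 2 := by omega
      all_goals simp

theorem table₁_eq_resZero (i j : ℤ ⊕ ℕ+) :
    table₁ i j = resZero (partialS (partialS (partialS (familyS i))) * familyS j) := by
  rcases i with m | l <;> rcases j with n | k
  · rw [partialS_third_inl, familyS_inl, smul_mul_assoc, monoS_mul, map_smul, table₁, add_zero,
      smul_eq_mul, resZero_monoS_zero_right]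
    by_cases h : m - 1 = 1 - n
    · rw [if_pos h, if_pos (by omega), show m = 2 - n by omega]
      push_cast
      ring
    · rw [if_neg h, if_neg (by omega), mul_zero]
  · exact (resZero_third_inl_inr m k).symm
  · rw [table₁_skew, ← resZero_third_inl_inr, functional_third_skew _ _ resZero_partialS, neg_neg]
  · rw [partialS_third_inr, familyS_inr, smul_mul_assoc, monoS_mul, map_smul, table₁, add_zero,
      resZero_monoS_of_nonneg le_rfl, smul_zero]

theorem resOne_third_inr_inl (n : ℕ+) (m : ℤ) :
    resOne (partialS (partialS (partialS (familyS (.inr n)))) * familyS (.inl m)) =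
      table₂ (.inr n) (.inl m) := by
  obtain ⟨n, rfl⟩ : ∃ n' : ℕ, n = n'.succPNat := ⟨n.natPred, by simp⟩
  have e2 : -((n.succPNat : ℕ) : ℤ) - 3 + 0 = -((n + 3 : ℕ) : ℤ) - 1 := by simp; ring
  rw [partialS_third_inr, familyS_inl, smul_mul_assoc, monoS_mul, map_smul, table₂, e2,
    zero_add, smul_eq_mul]
  rcases m with m | m
  · rw [Int.ofNat_eq_natCast, resOne_monoS_natCast]
    simp only [mixed₂, Nat.succPNat_coe, Nat.succ_eq_add_one]
    push_cast
    ring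
  · have e1 : Int.negSucc m = -(m : ℤ) - 1 := by omega
    have hf := third_factor_mul_choose n m
    simp only [mixed₂]
    rw [e1, resOne_monoS_neg, polePair, Nat.succPNat_coe, Nat.succ_eq_add_one,
      add_tsub_cancel_right, add_tsub_cancel_right, sub_zero, zero_sub, one_pow, mul_one, neg_neg,
      ← div_div, ← hf]
    have : ((-1 : ℂ) ^ (n + 1 + 1)) ≠ 0 := by simp
    rw [eq_div_iff this]
    have hs : ((-1 : ℂ) ^ n) ^ 2 = 1 := by rw [← pow_mul, mul_comm, pow_mul]; simp
    push_cast
    linear_combination ((n : ℂ) + 1) * (n + 2) * (n + 3) * ((m + (n + 3)).choose m : ℂ) * hs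

theorem table₂_eq_resOne (i j : ℤ ⊕ ℕ+) :
    table₂ i j = resOne (partialS (partialS (partialS (familyS i))) * familyS j) := by
  rcases i with m | l <;> rcases j with n | k
  · rw [partialS_third_inl, familyS_inl, smul_mul_assoc, monoS_mul, map_smul, table₂, add_zero,
      resOne_monoS_of_nonneg _ le_rfl, smul_zero]
  · rw [table₂_skew, ← resOne_third_inr_inl, functional_third_skew _ _ resOne_partialS, neg_neg]
  · exact (resOne_third_inr_inl l n).symm
  · rw [partialS_third_inr, familyS_inr, smul_mul_assoc, monoS_mul, map_smul, table₂, add_zero,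
      resOne_monoS_zero_left, if_neg, smul_zero]
    have := k.pos
    omega

theorem formOfTable_eq_functional {c : ℤ ⊕ ℕ+ → ℤ ⊕ ℕ+ → ℂ} {r : S →ₗ[ℂ] ℂ}
    (h : ∀ i j, c i j = r (partialS (partialS (partialS (familyS i))) * familyS j))
    (x y : Derivation ℂ S S) :
    formOfTable c x y = r (partialS (partialS (partialS (x s))) * y s) := by
  let ev : Derivation ℂ S S →ₗ[ℂ] S := derSEquiv.symm.toLinearMap
  have hev (i) : ev (basisDerS i) = familyS i := by simp [ev, basisDerS, basisS]
  let δ := partialS.toLinearMap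
  suffices formOfTable c = ((LinearMap.mul ℂ S).compr₂ r).compl₁₂ (δ ∘ₗ δ ∘ₗ δ ∘ₗ ev) ev from
    congr($this x y)
  refine basisDerS.ext fun i => basisDerS.ext fun j => ?_
  rw [formOfTable_basis, h]
  simp [hev, δ]

theorem phi₁_apply (x y : Derivation ℂ S S) :
    phi₁ x y = resZero (partialS (partialS (partialS (x s))) * y s) :=
  formOfTable_eq_functional table₁_eq_resZero x y

theorem phi₂_apply (x y : Derivation ℂ S S) :
    phi₂ x y = resOne (partialS (partialS (partialS (x s))) * y s) :=
  formOfTable_eq_functional table₂_eq_resOne x y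

theorem derivationS_apply (x : Derivation ℂ S S) (a : S) : x a = x s * partialS a := by
  have : x = x s • partialS := S_derivation_ext (by simp)
  exact DFunLike.congr_fun this a

/-- Since `x = x(s) ∂`, the bracket has coefficient `x(s) ∂(y(s)) - y(s) ∂(x(s))`, the expression in
`functional_third_jacobi`. -/
theorem isTwoCocycle_of_functional {φ : Derivation ℂ S S →ₗ[ℂ] Derivation ℂ S S →ₗ[ℂ] ℂ}
    {r : S →ₗ[ℂ] ℂ} (hr : ∀ a, r (partialS a) = 0)
    (h : ∀ x y, φ x y = r (partialS (partialS (partialS (x s))) * y s)) : IsTwoCocycle φ where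
  skew x y := by rw [h, h, functional_third_skew _ _ hr]
  jacobi x y z := by
    simp only [h, Derivation.commutator_apply, derivationS_apply x (y s),
      derivationS_apply x (z s), derivationS_apply y (x s), derivationS_apply y (z s),
      derivationS_apply z (x s), derivationS_apply z (y s)]
    exact functional_third_jacobi _ _ hr _ _ _

theorem isTwoCocycle_phiBar₁ : IsTwoCocycle phiBar₁ :=
  (isTwoCocycle_of_functional resZero_partialS phi₁_apply).compl₁₂_conjDer f

theorem isTwoCocycle_phiBar₂ : IsTwoCocycle phiBar₂ :=
  (isTwoCocycle_of_functional resOne_partialS phi₂_apply).compl₁₂_conjDer f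

/-! ### The derivation `D` in the two coordinates -/

theorem f_symm_s : f.symm (s : S) = (2⁻¹ : ℂ) • ((t : R) + 2 + u) := gHom_s

theorem D_ofNat_two : D 2 = 0 := by
  rw [← map_ofNat (algebraMap ℂ R) 2, Derivation.map_algebraMap]

/-- `D` exchanges `t + 2` and `u`, so it fixes their sum. This identifies `D` with `s ∂`. -/
theorem D_f_symm_s : D (f.symm s) = f.symm s := by
  rw [f_symm_s, Derivation.map_smul, D.map_add, D.map_add, D_t, D_u, D_ofNat_two]
  congr 1
  ring

theorem Phi_smul_D (a : R) : Phi (a • D) = (f a * s) • partialS := by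
  refine S_derivation_ext ?_
  change f (a * D (f.symm s)) = f a * s * partialS s
  rw [D_f_symm_s, map_mul, AlgEquiv.apply_symm_apply, partialS_s, mul_one]

theorem f_D (a : R) : f (D a) = s * partialS (f a) := by
  have h := DFunLike.congr_fun (Phi_smul_D 1) (f a)
  rw [one_smul, map_one, one_mul] at h
  simpa [Phi] using h

theorem f_symm_s_mul : ((f.symm ((s⁻¹ : Sˣ) : S))) * f.symm s = 1 := by
  rw [← map_mul]; simp

/-- Transported to `S`, the claim is that `s ∂` generates `Der(S) = S ∂`, which holds because `s` is
a unit. -/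
theorem derivationR_eq_smul_D (x : Derivation ℂ R R) :
    x = (x (f.symm s) * f.symm ((s⁻¹ : Sˣ) : S)) • D := by
  refine conjDer_injective f (S_derivation_ext ?_)
  rw [conjDer_apply, conjDer_apply, Derivation.smul_apply, smul_eq_mul, D_f_symm_s, mul_assoc,
    f_symm_s_mul, mul_one]

/-- The linear isomorphism `a ↦ a D` between `R` and `Der(R)`. -/
def derREquiv : R ≃ₗ[ℂ] Derivation ℂ R R where
  toFun a := a • D
  map_add' a b := add_smul a b _
  map_smul' c a := smul_assoc c a _
  invFun x := x (f.symm s) * f.symm ((s⁻¹ : Sˣ) : S)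
  left_inv a := by
    change a * D (f.symm s) * f.symm ((s⁻¹ : Sˣ) : S) = a
    rw [D_f_symm_s, mul_assoc, mul_comm (f.symm _),
      f_symm_s_mul, mul_one]
  right_inv x := (derivationR_eq_smul_D x).symm

/-- The functional `a ↦ r (f(a) ds / s)` on `R` for a functional `r` on `S`. -/
def logFunctional (r : S →ₗ[ℂ] ℂ) : R →ₗ[ℂ] ℂ :=
  r ∘ₗ LinearMap.mulRight ℂ ((s⁻¹ : Sˣ) : S) ∘ₗ f.toLinearMap

theorem logFunctional_apply (r : S →ₗ[ℂ] ℂ) (a : R) :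
    logFunctional r a = r (f a * ((s⁻¹ : Sˣ) : S)) := rfl

theorem logFunctional_D {r : S →ₗ[ℂ] ℂ} (hr : ∀ a, r (partialS a) = 0) (a : R) :
    logFunctional r (D a) = 0 := by
  rw [logFunctional_apply, f_D, ← hr (f a)]
  congr 1
  rw [mul_right_comm, Units.mul_inv, one_mul]

/-- With `θ = s ∂` one has `θ³ - θ = s³ ∂³ + 3 s² ∂²`, while `(s a)''' = s a''' + 3 a''`; hence `(s
a)''' (s b) ds = (θ³ a - θ a) b ds / s`. -/
theorem form_smul_D {φ : Derivation ℂ S S →ₗ[ℂ] Derivation ℂ S S →ₗ[ℂ] ℂ} {r : S →ₗ[ℂ] ℂ}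
    (h : ∀ x y, φ x y = r (partialS (partialS (partialS (x s))) * y s)) (a b : R) :
    φ (Phi (a • D)) (Phi (b • D)) = logFunctional r ((D (D (D a)) - D a) * b) := by
  rw [h, Phi_smul_D, Phi_smul_D, logFunctional_apply]
  congr 1
  have hs : (s : S) * ((s⁻¹ : Sˣ) : S) = 1 := by simp
  simp only [Derivation.smul_apply, partialS_s, smul_eq_mul, mul_one, map_mul, map_sub, f_D,
    Derivation.leibniz, map_add]
  generalize ((s⁻¹ : Sˣ) : S) = w at *
  generalize partialS (partialS (partialS (f a))) = a3
  generalize partialS (partialS (f a)) = a2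
  generalize partialS (f a) = a1
  linear_combination (-(s : S) * (s * a3 + 3 * a2) * f b) * hs

/-! ### Monomials of `R` -/

/-- The element `t ^ k` of `R`. -/
def tp (k : ℤ) : R := ((t ^ k : Rˣ) : R)

theorem tp_zero : tp 0 = 1 := by simp [tp]

theorem tp_mul (k l : ℤ) : tp k * tp l = tp (k + l) := by
  rw [tp, tp, tp, zpow_add, Units.val_mul]

theorem tp_add_one (k : ℤ) : tp (k + 1) = tp k * t := by
  rw [tp, tp, zpow_add_one, Units.val_mul]

theorem tpow_eq_tp (k : ℤ) : tpow k = tp k := by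
  have h (k : ℤ) : tpow (k + 1) = tpow k * t := tpow_add k 1
  induction k using Int.induction_on with
  | zero => rw [tpow_zero, tp_zero]
  | succ n ih => rw [h, tp_add_one, ih]
  | pred n ih =>
    have h1 := h (-n - 1)
    have h2 := tp_add_one (-n - 1)
    rw [sub_add_cancel] at h1 h2
    rw [← Units.mul_left_inj t, ← h1, ← h2, ih]

theorem e_eq (k : ℤ) : e k = tp k • D := rfl

theorem d_eq (k : ℤ) : d k = (tp k * u) • D := rfl

theorem tp_mul_u_mul_u (k : ℤ) : tp k * u * u = tp (k + 2) + (4 : ℂ) • tp (k + 1) := by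
  have h : u ^ 2 = (t : R) ^ 2 + 4 * t := u_sq
  rw [show k + 2 = k + 1 + 1 by ring, tp_add_one, tp_add_one, Algebra.smul_def, map_ofNat]
  linear_combination tp k * h

theorem D_tp (k : ℤ) : D (tp k) = (k : ℂ) • (tp (k - 1) * u) := by
  rw [tp, derivation_units_zpow, D_t, tp]

theorem D_tp_mul_u (k : ℤ) :
    D (tp k * u) = ((k : ℂ) + 1) • tp (k + 1) + (4 * (k : ℂ) + 2) • tp k := by
  have h := tp_mul_u_mul_u (k - 1)
  rw [sub_add_cancel, show k - 1 + 2 = k + 1 by ring] at h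
  have h2 : tp k * 2 = (2 : ℂ) • tp k := by rw [Algebra.smul_def, map_ofNat, mul_comm]
  rw [Derivation.leibniz, D_tp, D_u, smul_eq_mul, smul_eq_mul, mul_smul_comm, mul_comm u, h,
    mul_add (tp k), ← tp_add_one, h2]
  module

theorem D_third_tp (k : ℤ) : D (D (D (tp k))) - D (tp k) =
    ((k : ℂ) * (k ^ 2 - 1)) • (tp (k - 1) * u) +
      ((k : ℂ) * (k - 1) * (4 * k - 2)) • (tp (k - 2) * u) := by
  simp only [D_tp, D_tp_mul_u, Derivation.map_smul, map_add, sub_add_cancel, Int.cast_sub,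
    Int.cast_one, show k - 1 - 1 = k - 2 by ring]
  module

theorem D_third_tp_mul_u (k : ℤ) : D (D (D (tp k * u))) - D (tp k * u) =
    (((k : ℂ) + 1) * (k ^ 2 + 2 * k)) • tp (k + 1) +
      (((k : ℂ) + 1) ^ 2 * (4 * k + 2) + (4 * k + 2) * (k ^ 2 - 1)) • tp k +
      ((4 * (k : ℂ) + 2) * (k * (4 * k - 2))) • tp (k - 1) := by
  simp only [D_tp, D_tp_mul_u, Derivation.map_smul, map_add, sub_add_cancel, Int.cast_sub,
    Int.cast_one, Int.cast_add, add_sub_cancel_right]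
  module

theorem f_tp (k : ℤ) : f (tp k) = monoS (-k) (2 * k) := by
  have h : (f : R →ₐ[ℂ] S) t = (s⁻¹ * s1 ^ 2 : Sˣ) := by
    rw [Units.val_mul, Units.val_pow_eq_pow_val, coe_s1]; exact f_t
  have h2 := map_coe_zpow _ _ _ h k
  rw [mul_zpow, inv_zpow', ← zpow_natCast, ← zpow_mul] at h2
  exact h2

/-! ### Invariant functionals on `R` -/

theorem logFunctional_one (r : S →ₗ[ℂ] ℂ) : logFunctional r 1 = r (monoS (-1) 0) := by
  rw [logFunctional_apply, map_one, one_mul, coe_s_inv_eq_monoS]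

/-- The differential is `(s - s⁻¹) (s - 1) ^ (-2) ds = (2 / (s - 1) - 1 / s) ds`, with residues `-1`
at `0` and `2` at `1`. -/
theorem logFunctional_tp_neg_one_mul_u (r : S →ₗ[ℂ] ℂ) :
    logFunctional r (tp (-1) * u) = r (monoS 1 (-2)) - r (monoS (-1) (-2)) := by
  rw [logFunctional_apply, map_mul f, f_tp, f_u, coe_s_eq_monoS, coe_s_inv_eq_monoS,
    mul_sub (monoS _ _), sub_mul (_ * _), monoS_mul, monoS_mul, monoS_mul, monoS_mul, map_sub]
  norm_num

/-- For `n ≠ -1` the element `t ^ n u` is a nonzero multiple of `D (t ^ (n + 1))`. -/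
theorem functional_tp_mul_u {ρ : R →ₗ[ℂ] ℂ} (hρ : ∀ a, ρ (D a) = 0) (n : ℤ) :
    ρ (tp n * u) = ρ (tp (-1) * u) * if n = -1 then 1 else 0 := by
  split_ifs with h
  · rw [h, mul_one]
  · have h1 := hρ (tp (n + 1))
    rw [D_tp, add_sub_cancel_right, map_smul, smul_eq_zero] at h1
    rw [mul_zero]
    exact h1.resolve_left (by exact_mod_cast fun h2 => h (by omega))

theorem functional_tp_succ {ρ : R →ₗ[ℂ] ℂ} (hρ : ∀ a, ρ (D a) = 0) (n : ℤ) :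
    ((n : ℂ) + 1) * ρ (tp (n + 1)) = -(4 * (n : ℂ) + 2) * ρ (tp n) := by
  have h := hρ (tp n * u)
  rw [D_tp_mul_u, map_add, map_smul, map_smul, smul_eq_mul, smul_eq_mul] at h
  linear_combination h

theorem invFactorial_eq_succ (n : ℤ) : invFactorial n = ((n : ℂ) + 1) * invFactorial (n + 1) := by
  rcases n with n | n
  · change ((n.factorial : ℂ))⁻¹ = _ * (((n + 1).factorial : ℂ))⁻¹
    have h1 : (n.factorial : ℂ) ≠ 0 := by exact_mod_cast n.factorial_ne_zero
    have h2 : (n : ℂ) + 1 ≠ 0 := by exact_mod_cast n.succ_ne_zero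
    rw [Nat.factorial_succ]
    rw [Int.ofNat_eq_natCast]
    push_cast
    field_simp
  · rcases n with _ | n
    · simp [invFactorial]
    · rw [show Int.negSucc (n + 1) + 1 = Int.negSucc n by omega]
      simp [invFactorial]

/-- Both sides satisfy the recursion of `functional_tp_succ`. Going up one divides by `n + 1`,
nonzero for `n ≥ 0`; going down by `4 n + 2`, nonzero for every integer. At `n = -1` the recursion
forces `ρ (t⁻¹) = 0`, matching the convention `1 / n! = 0` for `n < 0`. -/
theorem functional_tp {ρ : R →ₗ[ℂ] ℂ} (hρ : ∀ a, ρ (D a) = 0) (n : ℤ) :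
    ρ (tp n) = ρ 1 * ((-2 : ℂ) ^ n * oddDoubleFactorial n * invFactorial n) := by
  have hrec (n : ℤ) : ((n : ℂ) + 1) * ((-2 : ℂ) ^ (n + 1) * oddDoubleFactorial (n + 1) *
      invFactorial (n + 1)) =
        -(4 * (n : ℂ) + 2) * ((-2 : ℂ) ^ n * oddDoubleFactorial n * invFactorial n) := by
    rw [invFactorial_eq_succ n, oddDoubleFactorial_succ, zpow_add_one₀ (by norm_num)]
    ring
  induction n using Int.induction_on with
  | zero =>
    have h1 : oddDoubleFactorial 0 = 1 := Finset.prod_range_zero _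
    have h2 : invFactorial 0 = 1 := by change ((Nat.factorial 0 : ℂ))⁻¹ = 1; simp
    rw [tp_zero, h1, h2, zpow_zero, mul_one, mul_one, mul_one]
  | succ n ih =>
    have h : ((n : ℤ) : ℂ) + 1 ≠ 0 := by exact_mod_cast n.succ_ne_zero
    refine mul_left_cancel₀ h ?_
    rw [functional_tp_succ hρ, ih]
    linear_combination -ρ 1 * hrec n
  | pred n ih =>
    have h : -(4 * ((-(n : ℤ) - 1 : ℤ) : ℂ) + 2) ≠ 0 := by
      exact_mod_cast (by omega : -(4 * (-(n : ℤ) - 1) + 2) ≠ 0)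
    refine mul_left_cancel₀ h ?_
    have h1 := functional_tp_succ hρ (-n - 1)
    have h2 := hrec (-n - 1)
    rw [sub_add_cancel] at h1 h2
    rw [← h1, ih]
    linear_combination ρ 1 * h2

/-- The product is a combination of `t ^ (k + l - 1) u` and `t ^ (k + l - 2) u`, and `ρ` sees only
`t⁻¹ u`; this is the source of the two Kronecker deltas. -/
theorem functional_ee {ρ : R →ₗ[ℂ] ℂ} (hρ : ∀ a, ρ (D a) = 0) (k l : ℤ) :
    ρ ((D (D (D (tp k))) - D (tp k)) * tp l) = -ρ (tp (-1) * u) *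
      (2 * ((l : ℂ) ^ 2 - l) * (2 * l - 1) * (if k + l = 1 then 1 else 0) +
        ((l : ℂ) ^ 3 - l) * (if k + l = 0 then 1 else 0)) := by
  rw [D_third_tp, add_mul, smul_mul_assoc, smul_mul_assoc, mul_right_comm (tp (k - 1)), tp_mul,
    mul_right_comm (tp (k - 2)), tp_mul, map_add, map_smul, map_smul, functional_tp_mul_u hρ (k - 1 + l),
    functional_tp_mul_u hρ (k - 2 + l), smul_eq_mul, smul_eq_mul]
  by_cases h0 : k + l = 0
  · obtain rfl : k = -l := by omega
    simp [show -l - 1 + l = -1 by ring, show -l - 2 + l = -2 by ring]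
    ring
  by_cases h1 : k + l = 1
  · obtain rfl : k = 1 - l := by omega
    simp [show 1 - l - 2 + l = -1 by ring]
    ring
  rw [if_neg h0, if_neg h1, if_neg (by omega), if_neg (by omega)]
  ring

theorem functional_dd {ρ : R →ₗ[ℂ] ℂ} (hρ : ∀ a, ρ (D a) = 0) (k l : ℤ) :
    ρ ((D (D (D (tp k * u))) - D (tp k * u)) * (tp l * u)) = -ρ (tp (-1) * u) *
      ((l : ℂ) * (l + 1) * (l + 2) * (if k + l = -2 then 1 else 0) +
        4 * (l : ℂ) * (2 * l + 1) * (l + 1) * (if k + l = -1 then 1 else 0) +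
        4 * (l : ℂ) * (2 * l - 1) * (2 * l + 1) * (if k + l = 0 then 1 else 0)) := by
  rw [D_third_tp_mul_u, add_mul, add_mul, smul_mul_assoc, smul_mul_assoc, smul_mul_assoc,
    ← mul_assoc (tp _), ← mul_assoc (tp _), ← mul_assoc (tp _), tp_mul, tp_mul, tp_mul, map_add, map_add, map_smul,
    map_smul, map_smul, functional_tp_mul_u hρ (k + 1 + l), functional_tp_mul_u hρ (k + l),
    functional_tp_mul_u hρ (k - 1 + l), smul_eq_mul, smul_eq_mul, smul_eq_mul]
  by_cases h0 : k + l = 0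
  · obtain rfl : k = -l := by omega
    simp [show -l - 1 + l = -1 by ring, show -l + 1 + l = 1 by ring]
    ring
  by_cases h1 : k + l = -1
  · obtain rfl : k = -1 - l := by omega
    simp [show -1 - l - 1 + l = -2 by ring, show -1 - l + 1 + l = 0 by ring]
    ring
  by_cases h2 : k + l = -2
  · obtain rfl : k = -2 - l := by omega
    simp [show -2 - l - 1 + l = -3 by ring, show -2 - l + 1 + l = -1 by ring]
    ring
  rw [if_neg h0, if_neg h1, if_neg h2, if_neg (by omega), if_neg (by omega)]
  ring

theorem functional_ed {ρ : R →ₗ[ℂ] ℂ} (hρ : ∀ a, ρ (D a) = 0) (k l : ℤ) :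
    ρ ((D (D (D (tp k))) - D (tp k)) * (tp l * u)) = ρ 1 *
      (6 * (-1 : ℂ) ^ (k + l) * (2 : ℂ) ^ (k + l) * ((k : ℂ) - 1) * k * l *
        oddDoubleFactorial (k + l - 1) * invFactorial (k + l + 1)) := by
  have e1 : (tp (k - 1) * u) * (tp l * u) = tp (k + l + 1) + (4 : ℂ) • tp (k + l) := by
    rw [← mul_assoc, mul_right_comm _ u, tp_mul, tp_mul_u_mul_u,
      show k - 1 + l + 2 = k + l + 1 by ring, show k - 1 + l + 1 = k + l by ring]
  have e2 : (tp (k - 2) * u) * (tp l * u) = tp (k + l) + (4 : ℂ) • tp (k + l - 1) := by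
    rw [← mul_assoc, mul_right_comm _ u, tp_mul, tp_mul_u_mul_u,
      show k - 2 + l + 2 = k + l by ring, show k - 2 + l + 1 = k + l - 1 by ring]
  rw [D_third_tp, add_mul, smul_mul_assoc, smul_mul_assoc, e1, e2]
  simp only [map_add, map_smul, smul_eq_mul, functional_tp hρ]
  obtain ⟨n, hn⟩ : ∃ n, n = k + l := ⟨_, rfl⟩
  have hl : (l : ℂ) = n - k := by rw [hn]; push_cast; ring
  have hp : (-1 : ℂ) ^ n * 2 ^ n = (-2) ^ n := by rw [← mul_zpow]; norm_num
  have hz1 : (-2 : ℂ) ^ (n + 1) = (-2) ^ n * (-2) := zpow_add_one₀ (by norm_num) _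
  have hz2 : (-2 : ℂ) ^ (n - 1) * (-2) = (-2) ^ n := by
    rw [← zpow_add_one₀ (by norm_num), sub_add_cancel]
  have ho1 := oddDoubleFactorial_succ n
  have ho2 := oddDoubleFactorial_succ (n - 1)
  have hi1 := invFactorial_eq_succ n
  have hi2 := invFactorial_eq_succ (n - 1)
  rw [sub_add_cancel] at ho2 hi2
  -- With `n = k + l`, the values of `ρ` at `t ^ (n + 1)`, `t ^ n` and `t ^ (n - 1)` are all reduced
  -- to the lowest power of `-2`, the lowest double factorial and `1 / (n + 1)!`; a polynomial
  -- identity in `n` and `k` remains.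
  rw [mul_assoc (6 : ℂ), ← hn, hp, hl, ho1, hi2, ho2, hi1, hz1, ← hz2]
  push_cast
  ring

theorem logFunctional_resZero_one : logFunctional resZero 1 = 1 := by
  rw [logFunctional_one, resZero_monoS_zero_right, if_pos rfl]

theorem logFunctional_resOne_one : logFunctional resOne 1 = 0 := by
  rw [logFunctional_one, resOne_monoS_of_nonneg _ le_rfl]

theorem logFunctional_resZero_tp_neg_one_mul_u : logFunctional resZero (tp (-1) * u) = -1 := by
  have h := resZero_monoS_neg 1 0
  norm_num at h
  rw [logFunctional_tp_neg_one_mul_u, resZero_monoS_of_nonneg zero_le_one, h, zero_sub]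

theorem logFunctional_resOne_tp_neg_one_mul_u : logFunctional resOne (tp (-1) * u) = 2 := by
  have h := resOne_monoS_neg 0 1
  have h1 := resOne_monoS_natCast 1 1
  norm_num at h h1
  rw [logFunctional_tp_neg_one_mul_u, h, h1]
  norm_num

/-! ### The basis of `Der(R)` -/

/-- The family `t ^ k`, `t ^ k u` (`k ∈ ℤ`) of elements of `R`. -/
def familyR : ℤ ⊕ ℤ → R := Sum.elim tp fun k => tp k * u

theorem sumElim_e_d : Sum.elim e d = derREquiv ∘ familyR := by
  funext i
  rcases i with k | k <;> rfl

theorem mul_u_mem_span_familyR {x : R} (hx : x ∈ Submodule.span ℂ (Set.range familyR)) :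
    x * u ∈ Submodule.span ℂ (Set.range familyR) := by
  induction hx using Submodule.span_induction with
  | zero => rw [zero_mul]; exact zero_mem _
  | add x y _ _ hx hy => rw [add_mul]; exact add_mem hx hy
  | smul c x _ hx => rw [smul_mul_assoc]; exact Submodule.smul_mem _ c hx
  | mem x hx =>
    obtain ⟨i, rfl⟩ := hx
    rcases i with k | k
    · exact Submodule.subset_span ⟨.inr k, rfl⟩
    · change tp k * u * u ∈ _
      rw [tp_mul_u_mul_u]
      exact add_mem (Submodule.subset_span ⟨.inl _, rfl⟩)
        (Submodule.smul_mem _ _ (Submodule.subset_span ⟨.inl _, rfl⟩))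

theorem of_mem_span_familyR (a : LaurentPolynomial ℂ) :
    (AdjoinRoot.of _ a : R) ∈ Submodule.span ℂ (Set.range familyR) := by
  induction a using LaurentPolynomial.induction_on' with
  | add p q hp hq => rw [map_add (AdjoinRoot.of _)]; exact add_mem hp hq
  | C_mul_T n a =>
    have h : (AdjoinRoot.of _ (LaurentPolynomial.C a * T n) : R) = a • tp n := by
      rw [map_mul, ← tpow_eq_tp, Algebra.smul_def]
      rfl
    rw [h]
    exact Submodule.smul_mem _ _ (Submodule.subset_span ⟨.inl n, rfl⟩)

theorem span_familyR : Submodule.span ℂ (Set.range familyR) = ⊤ := by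
  refine eq_top_iff.2 fun x _ => ?_
  obtain ⟨p, rfl⟩ := AdjoinRoot.mk_surjective x
  induction p using Polynomial.induction_on' with
  | add p q hp hq => rw [map_add (AdjoinRoot.mk _)]; exact add_mem (hp trivial) (hq trivial)
  | monomial n a =>
    rw [← Polynomial.C_mul_X_pow_eq_monomial, map_mul, map_pow, AdjoinRoot.mk_C, AdjoinRoot.mk_X]
    change AdjoinRoot.of _ a * u ^ n ∈ _
    clear * -
    induction n with
    | zero => rw [pow_zero, mul_one]; exact of_mem_span_familyR a
    | succ n ih => rw [pow_succ u, ← mul_assoc]; exact mul_u_mem_span_familyR ih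

theorem logFunctional_resOne_tp (n : ℤ) : logFunctional resOne (tp n) = 0 := by
  rw [functional_tp (logFunctional_D resOne_partialS), logFunctional_resOne_one, zero_mul]

theorem logFunctional_resOne_tp_mul_u (n : ℤ) :
    logFunctional resOne (tp n * u) = 2 * if n = -1 then 1 else 0 := by
  rw [functional_tp_mul_u (logFunctional_D resOne_partialS),
    logFunctional_resOne_tp_neg_one_mul_u]

theorem linearIndependent_familyR : LinearIndependent ℂ familyR := by
  -- Dual family for the residue pairing at `s = 1`: that functional kills every `t ^ n` and takes
  -- the value `2` on `t⁻¹ u`, hence the factor `2⁻¹`.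
  let dual : ℤ ⊕ ℤ → R := Sum.elim (fun k => tp (-1 - k) * u) fun k => tp (-1 - k)
  let F (i : ℤ ⊕ ℤ) : Module.Dual ℂ R :=
    (2⁻¹ : ℂ) • logFunctional resOne ∘ₗ LinearMap.mulRight ℂ (dual i)
  have hF (i j) : F i (familyR j) = if i = j then 1 else 0 := by
    change (2⁻¹ : ℂ) * logFunctional resOne (familyR j * dual i) = _
    rcases i with k | k <;> rcases j with l | l
    · change 2⁻¹ * logFunctional resOne (tp l * (tp (-1 - k) * u)) = _
      rw [← mul_assoc, tp_mul, logFunctional_resOne_tp_mul_u]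
      by_cases h : k = l
      · rw [if_pos (by omega), if_pos (by rw [h])]; norm_num
      · rw [if_neg (by omega), if_neg (by simpa using h)]; norm_num
    · change 2⁻¹ * logFunctional resOne (tp l * u * (tp (-1 - k) * u)) = _
      rw [← mul_assoc, mul_right_comm _ u, tp_mul, tp_mul_u_mul_u, map_add, map_smul,
        logFunctional_resOne_tp, logFunctional_resOne_tp]
      simp
    · change 2⁻¹ * logFunctional resOne (tp l * tp (-1 - k)) = _
      rw [tp_mul, logFunctional_resOne_tp]
      simp
    · change 2⁻¹ * logFunctional resOne (tp l * u * tp (-1 - k)) = _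
      rw [mul_right_comm, tp_mul, logFunctional_resOne_tp_mul_u]
      by_cases h : k = l
      · rw [if_pos (by omega), if_pos (by rw [h])]; norm_num
      · rw [if_neg (by omega), if_neg (by simpa using h)]; norm_num
  exact LinearIndependent.of_pairwise_dual_eq_zero_one _ F
    (fun i j h => (hF i j).trans (if_neg h)) fun i => by rw [hF, if_pos rfl]

theorem linearIndependent_e_d : LinearIndependent ℂ (Sum.elim e d) := by
  rw [sumElim_e_d]
  exact linearIndependent_familyR.map' derREquiv.toLinearMap derREquiv.ker

theorem span_e_d : Submodule.span ℂ (Set.range (Sum.elim e d)) = ⊤ := by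
  rw [sumElim_e_d, Set.range_comp]
  change Submodule.span ℂ (derREquiv.toLinearMap '' _) = ⊤
  rw [Submodule.span_image, span_familyR, Submodule.map_top]
  exact derREquiv.range

/-! ### Values of the pulled back forms -/

theorem phiBar₁_smul_D (a b : R) :
    phiBar₁ (a • D) (b • D) = logFunctional resZero ((D (D (D a)) - D a) * b) :=
  form_smul_D phi₁_apply a b

theorem phiBar₂_smul_D (a b : R) :
    phiBar₂ (a • D) (b • D) = logFunctional resOne ((D (D (D a)) - D a) * b) :=
  form_smul_D phi₂_apply a b

theorem phiBar₁_e_e (k l : ℤ) : phiBar₁ (e k) (e l) =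
    2 * ((l : ℂ) ^ 2 - l) * (2 * l - 1) * (if k + l = 1 then 1 else 0) +
      ((l : ℂ) ^ 3 - l) * (if k + l = 0 then 1 else 0) := by
  rw [e_eq, e_eq, phiBar₁_smul_D, functional_ee (logFunctional_D resZero_partialS),
    logFunctional_resZero_tp_neg_one_mul_u, neg_neg, one_mul]

theorem phiBar₁_e_d (k l : ℤ) : phiBar₁ (e k) (d l) =
    6 * (-1 : ℂ) ^ (k + l) * (2 : ℂ) ^ (k + l) * ((k : ℂ) - 1) * k * l *
      oddDoubleFactorial (k + l - 1) * invFactorial (k + l + 1) := by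
  rw [e_eq, d_eq, phiBar₁_smul_D, functional_ed (logFunctional_D resZero_partialS),
    logFunctional_resZero_one, one_mul]

theorem phiBar₁_d_d (k l : ℤ) : phiBar₁ (d k) (d l) =
    (l : ℂ) * (l + 1) * (l + 2) * (if k + l = -2 then 1 else 0) +
      4 * (l : ℂ) * (2 * l + 1) * (l + 1) * (if k + l = -1 then 1 else 0) +
      4 * (l : ℂ) * (2 * l - 1) * (2 * l + 1) * (if k + l = 0 then 1 else 0) := by
  rw [d_eq, d_eq, phiBar₁_smul_D, functional_dd (logFunctional_D resZero_partialS),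
    logFunctional_resZero_tp_neg_one_mul_u, neg_neg, one_mul]

theorem phiBar₂_e_e_eq (k l : ℤ) : phiBar₂ (e k) (e l) = -2 * phiBar₁ (e k) (e l) := by
  rw [phiBar₁_e_e, e_eq, e_eq, phiBar₂_smul_D, functional_ee (logFunctional_D resOne_partialS),
    logFunctional_resOne_tp_neg_one_mul_u]

theorem phiBar₂_e_d (k l : ℤ) : phiBar₂ (e k) (d l) = 0 := by
  rw [e_eq, d_eq, phiBar₂_smul_D, functional_ed (logFunctional_D resOne_partialS),
    logFunctional_resOne_one, zero_mul]

theorem phiBar₂_d_d_eq (k l : ℤ) : phiBar₂ (d k) (d l) = -2 * phiBar₁ (d k) (d l) := by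
  rw [phiBar₁_d_d, d_eq, d_eq, phiBar₂_smul_D, functional_dd (logFunctional_D resOne_partialS),
    logFunctional_resOne_tp_neg_one_mul_u]

theorem lie_e_e (k l : ℤ) : ⁅e k, e l⁆ = ((l : ℂ) - k) • d (k + l - 1) := by
  refine derREquiv.symm.injective ?_
  -- A derivation of `R` is determined by its value at `f⁻¹(s)`, which `D` fixes.
  change ⁅e k, e l⁆ (f.symm s) * f.symm ((s⁻¹ : Sˣ) : S) =
    ((l : ℂ) - k) • d (k + l - 1) (f.symm s) * f.symm ((s⁻¹ : Sˣ) : S)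
  congr 1
  have hl := tp_mul k (l - 1)
  have hk := tp_mul l (k - 1)
  rw [show k + (l - 1) = k + l - 1 by ring] at hl
  rw [show l + (k - 1) = k + l - 1 by ring] at hk
  simp only [Derivation.commutator_apply, e_eq, d_eq, Derivation.smul_apply, smul_eq_mul,
    D_f_symm_s, Derivation.leibniz, D_tp]
  simp only [Algebra.smul_def, map_sub]
  linear_combination (algebraMap ℂ R l * u * f.symm s) * hl -
    (algebraMap ℂ R k * u * f.symm s) * hk

theorem not_isTwoCoboundary_of_e_e
    {φ : Derivation ℂ R R →ₗ[ℂ] Derivation ℂ R R →ₗ[ℂ] ℂ} {c : ℂ} (hc : c ≠ 0)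
    (h : ∀ k l, φ (e k) (e l) = c * phiBar₁ (e k) (e l)) : ¬ IsTwoCoboundary φ := by
  rintro ⟨g, hg⟩
  -- The brackets are `2 d (-1)` and `4 d (-1)`, while the values of `φ` are `0` and `6 c`: the
  -- first forces `g (d (-1)) = 0`, the second then `c = 0`.
  have h1 := hg (e (-1)) (e 1)
  have h2 := hg (e (-2)) (e 2)
  rw [h, phiBar₁_e_e, lie_e_e, map_smul, smul_eq_mul] at h1 h2
  norm_num at h1 h2
  rw [h1] at h2
  norm_num at h2
  exact hc h2

end ThreePoint

end
theorem mainTheorem1 :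
    -- the elements `e_k`, `d_k` form a basis of `Der(R)`
    (LinearIndependent ℂ (Sum.elim ThreePoint.e ThreePoint.d) ∧
      Submodule.span ℂ (Set.range (Sum.elim ThreePoint.e ThreePoint.d)) = ⊤) ∧
    -- the pulled back forms are cocycles that are not coboundaries
    (ThreePoint.IsTwoCocycle ThreePoint.phiBar₁ ∧
      ¬ ThreePoint.IsTwoCoboundary ThreePoint.phiBar₁) ∧
    (ThreePoint.IsTwoCocycle ThreePoint.phiBar₂ ∧
      ¬ ThreePoint.IsTwoCoboundary ThreePoint.phiBar₂) ∧
    -- values of the first cocycle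
    (∀ k l : ℤ, ThreePoint.phiBar₁ (ThreePoint.e k) (ThreePoint.e l) =
      2 * ((l : ℂ) ^ 2 - l) * (2 * l - 1) * (if k + l = 1 then 1 else 0) +
        ((l : ℂ) ^ 3 - l) * (if k + l = 0 then 1 else 0)) ∧
    (∀ k l : ℤ, ThreePoint.phiBar₁ (ThreePoint.e k) (ThreePoint.d l) =
      6 * (-1 : ℂ) ^ (k + l) * (2 : ℂ) ^ (k + l) * ((k : ℂ) - 1) * k * l *
        ThreePoint.oddDoubleFactorial (k + l - 1) * ThreePoint.invFactorial (k + l + 1)) ∧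
    (∀ k l : ℤ, ThreePoint.phiBar₁ (ThreePoint.d l) (ThreePoint.e k) =
      -ThreePoint.phiBar₁ (ThreePoint.e k) (ThreePoint.d l)) ∧
    (∀ k l : ℤ, ThreePoint.phiBar₁ (ThreePoint.d k) (ThreePoint.d l) =
      (l : ℂ) * (l + 1) * (l + 2) * (if k + l = -2 then 1 else 0) +
        4 * (l : ℂ) * (2 * l + 1) * (l + 1) * (if k + l = -1 then 1 else 0) +
        4 * (l : ℂ) * (2 * l - 1) * (2 * l + 1) * (if k + l = 0 then 1 else 0)) ∧
    -- values of the second cocycle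
    (∀ k l : ℤ, ThreePoint.phiBar₂ (ThreePoint.e k) (ThreePoint.e l) =
      -2 * ((l : ℂ) ^ 3 - l) * (if k + l = 0 then 1 else 0) -
        4 * (l : ℂ) * (l - 1) * (2 * l - 1) * (if k + l = 1 then 1 else 0)) ∧
    (∀ k l : ℤ, ThreePoint.phiBar₂ (ThreePoint.e k) (ThreePoint.d l) =
        -ThreePoint.phiBar₂ (ThreePoint.d l) (ThreePoint.e k) ∧
      ThreePoint.phiBar₂ (ThreePoint.e k) (ThreePoint.d l) = 0) ∧
    (∀ k l : ℤ, ThreePoint.phiBar₂ (ThreePoint.d k) (ThreePoint.d l) =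
      -2 * (l : ℂ) * (l + 1) * (l + 2) * (if k + l = -2 then 1 else 0) -
        8 * (l : ℂ) * (l + 1) * (2 * l + 1) * (if k + l = -1 then 1 else 0) -
        8 * (l : ℂ) * (2 * l - 1) * (2 * l + 1) * (if k + l = 0 then 1 else 0)) ∧
    -- comparison of the two cocycles
    (∀ k l : ℤ, ThreePoint.phiBar₂ (ThreePoint.d k) (ThreePoint.d l) =
      -2 * ThreePoint.phiBar₁ (ThreePoint.d k) (ThreePoint.d l)) ∧
    (∀ k l : ℤ, ThreePoint.phiBar₂ (ThreePoint.e k) (ThreePoint.e l) =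
      -2 * ThreePoint.phiBar₁ (ThreePoint.e k) (ThreePoint.e l)) := by
  open ThreePoint in
  refine ⟨⟨linearIndependent_e_d, span_e_d⟩,
    ⟨isTwoCocycle_phiBar₁,
      not_isTwoCoboundary_of_e_e one_ne_zero fun k l => (one_mul _).symm⟩,
    ⟨isTwoCocycle_phiBar₂,
      not_isTwoCoboundary_of_e_e (neg_ne_zero.2 two_ne_zero) phiBar₂_e_e_eq⟩,
    phiBar₁_e_e, phiBar₁_e_d, fun k l => isTwoCocycle_phiBar₁.skew _ _, phiBar₁_d_d,
    fun k l => ?_, fun k l => ⟨isTwoCocycle_phiBar₂.skew _ _, phiBar₂_e_d k l⟩, fun k l => ?_,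
    phiBar₂_d_d_eq, phiBar₂_e_e_eq⟩
  · rw [ThreePoint.phiBar₂_e_e_eq, ThreePoint.phiBar₁_e_e]
    ring
  · rw [ThreePoint.phiBar₂_d_d_eq, ThreePoint.phiBar₁_d_d]
    ring
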